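/- Everything is $C^\infty$. Let $(N,g)$ be a Riemannian manifold of dimension $n+1$ with Levi-Civita connection $\nabla$, and let $M$ be a connected (immersed, in particular embedded) hypersurface of $N$, of dimension $n$, with the induced metric. Let $Y : M \to TN$ be a smooth vector field of $N$ along $M$, not identically zero, which is parallel along $M$, i.e. $\nabla_W Y = 0$ for every $W \in TM$. Suppose that $M$ is a helix submanifold of $N$ with respect to $Y$, i.e. the function $$h(x) = \max\{\, g(w, Y(x)) \mid w \in T_xM,\ g(w,w) = 1 \,\}, \qquad x \in M,$$ is constant. Then: (a) If $Y$ is orthogonal to $M$ at some point, then $M$ is a totally geodesic submanifold of $N$, i.e. every geodesic of $M$ is a geodesic of $N$. (b) If $Y$ is tangent to $M$ at some point, then $M$ is locally a Riemannian product $\mathbb{R} \times M_2$, i.e. each point of $M$ has an open neighbourhood that is isometric to an open subset of a Riemannian product $\mathbb{R} \times M_2$ for some Riemannian manifold $M_2$ (which may depend on the point). (c) If $Y$ is transversal to $M$ at some point (i.e. at some $x \in M$, $T_xN = T_xM \oplus \mathbb{R}\,Y(x)$) and the integral curves of $\tan(Y)$ are geodesics of $M$, then they are geodesics of $N$. Here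 $\tan(Y)(x) \in T_xM$ is the component of $Y(x)$ tangent to $M$ in the orthogonal decomposition $T_xN = T_xM \oplus T_xM^\perp$. -/

import Mathlib

open Set Bundle
open scoped Manifold ContDiff Topology

noncomputable section

namespace HelixHypersurface

section General

variable {E : Type*} [NormedAddCommGroup E] [NormedSpace ℝ E]
  {H : Type*} [TopologicalSpace H] {I : ModelWithCorners ℝ E H}
  {M : Type*} [TopologicalSpace M] [ChartedSpace H M]
  {E' : Type*} [NormedAddCommGroup E'] [NormedSpace ℝ E']
  {H' : Type*} [TopologicalSpace H'] {J : ModelWithCorners ℝ E' H'}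
  {N : Type*} [TopologicalSpace N] [ChartedSpace H' N]

/-- A field of bilinear forms on the tangent spaces of a manifold.  Riemannian metrics are used in
this form: the metric field of `g : ContMDiffRiemannianMetric ..` is `g.inner`. -/
abbrev MetricField (I : ModelWithCorners ℝ E H) (M : Type*) [TopologicalSpace M]
    [ChartedSpace H M] :=
  ∀ x : M, TangentSpace I x →L[ℝ] TangentSpace I x →L[ℝ] ℝ

/-- The pullback `f^* g`, i.e. `(f^* g)_x(u, v) = g_{f x}(df u, df v)`.  For an immersion `f` into a
Riemannian manifold this is the induced Riemannian metric. -/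
def pullbackMetric (I : ModelWithCorners ℝ E H) (g : MetricField J N) (f : M → N) :
    MetricField I M :=
  fun x =>
    let B : E' →L[ℝ] E' →L[ℝ] ℝ := g (f x)
    let A : E →L[ℝ] E' := mfderiv I J f x
    let C : E →L[ℝ] E →L[ℝ] ℝ := B.bilinearComp A A
    C

@[simp] theorem pullbackMetric_apply (g : MetricField J N) (f : M → N) (x : M)
    (u v : TangentSpace I x) :
    pullbackMetric I g f x u v = g (f x) (mfderiv I J f x u) (mfderiv I J f x v) := rfl

theorem apply_inverse_of_pos {V : Type*} [NormedAddCommGroup V] [NormedSpace ℝ V]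
    [FiniteDimensional ℝ V] (B : V →L[ℝ] V →L[ℝ] ℝ) (hB : ∀ v, v ≠ 0 → 0 < B v v)
    (l : V →L[ℝ] ℝ) : B (B.inverse l) = l := by
  have hinj : Function.Injective B := by
    rw [injective_iff_map_eq_zero]
    intro v hv
    by_contra h
    have := hB v h
    simp [hv] at this
  have hfr : Module.finrank ℝ V = Module.finrank ℝ (V →L[ℝ] ℝ) := by
    rw [← LinearEquiv.finrank_eq (LinearMap.toContinuousLinearMap (𝕜 := ℝ) (E := V) (F' := ℝ))]
    exact (Subspace.dual_finrank_eq (K := ℝ) (V := V)).symm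
  let e : V ≃L[ℝ] (V →L[ℝ] ℝ) :=
    (LinearEquiv.ofInjectiveOfFinrankEq B.toLinearMap hinj hfr).toContinuousLinearEquiv
  have he : B = (e : V →L[ℝ] V →L[ℝ] ℝ) := by
    ext; rfl
  rw [he, ContinuousLinearMap.inverse_equiv]
  simp

/-- The metric read in the preferred chart `φ` around `x`: at `y` in the target of `φ` this is
`(u, v) ↦ g(dφ⁻¹ u, dφ⁻¹ v)`. -/
def chartMetric (g : MetricField I M) (x : M) (y : E) : E →L[ℝ] E →L[ℝ] ℝ :=
  pullbackMetric 𝓘(ℝ, E) g (extChartAt I x).symm y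

/-- The Christoffel symbols of the Levi-Civita connection of `g` at `x`, in the preferred chart
around `x`, as a map `(u, v) ↦ Γ(u, v)`.  With `G` the metric in that chart, `Γ(u, v)` is the vector
with `G(Γ(u, v), w) = ½ (∂_u G(v, w) + ∂_v G(u, w) - ∂_w G(u, v))` for all `w`
(see `chartMetric_christoffel`). -/
def christoffel (g : MetricField I M) (x : M) (u v : E) : E :=
  let G := chartMetric g x
  let y := extChartAt I x x
  let dG := fderiv ℝ G y
  (G y).inverse ((1 / 2 : ℝ) • (dG u v + dG v u - (dG.flip u).flip v))

theorem chartMetric_christoffel [FiniteDimensional ℝ E] [I.Boundaryless] [IsManifold I 1 M]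
    (g : MetricField I M) (hg : ∀ x v, v ≠ 0 → 0 < g x v v) (x : M) (u v w : E) :
    chartMetric g x (extChartAt I x x) (christoffel g x u v) w =
      (1 / 2) * (fderiv ℝ (chartMetric g x) (extChartAt I x x) u v w +
        fderiv ℝ (chartMetric g x) (extChartAt I x x) v u w -
        fderiv ℝ (chartMetric g x) (extChartAt I x x) w u v) := by
  have hpos : ∀ v, v ≠ 0 → 0 < chartMetric g x (extChartAt I x x) v v := by
    intro v hv
    refine hg _ _ fun h0 => hv ?_
    have h1 := isInvertible_mfderivWithin_extChartAt_symm (I := I) (mem_extChartAt_target x)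
    rw [I.range_eq_univ, mfderivWithin_univ] at h1
    exact h1.injective (h0.trans (map_zero _).symm)
  rw [christoffel, apply_inverse_of_pos _ hpos]
  simp

/-- The covariant derivative `∇_w V` at `p`, with respect to the Levi-Civita connection of `(N, g)`,
of a vector field `V` along a map `f : M → N`, in the direction `w ∈ T_p M`.  In the chart `φ` around
`f p` it is `∂_w V̂ + Γ(df w, V p)`, where `V̂ q = dφ (V q)` is the coordinate expression of `V`. -/
def covDerivAlong (I : ModelWithCorners ℝ E H) (g : MetricField J N) (f : M → N)
    (V : ∀ p : M, TangentSpace J (f p)) (p : M) (w : TangentSpace I p) : TangentSpace J (f p) :=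
  let φ := extChartAt J (f p)
  let V' : M → E' := fun q => mfderiv J 𝓘(ℝ, E') φ (f q) (V q)
  let dV : E' := mfderiv I 𝓘(ℝ, E') V' p w
  let df : E' := mfderiv J 𝓘(ℝ, E') φ (f p) (mfderiv I J f p w)
  (mfderiv J 𝓘(ℝ, E') φ (f p)).inverse (dV + christoffel g (f p) df (V' p))

/-- The velocity vector of a curve. -/
def velocity (J : ModelWithCorners ℝ E' H') (γ : ℝ → N) (t : ℝ) : TangentSpace J (γ t) :=
  mfderiv 𝓘(ℝ, ℝ) J γ t (1 : ℝ)

/-- `γ` is a geodesic of `(N, g)` on the open interval `s`: it is smooth there and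
`∇_{γ'} γ' = 0`. -/
def IsGeodesicOn (g : MetricField J N) (γ : ℝ → N) (s : Set ℝ) : Prop :=
  ContMDiffOn 𝓘(ℝ, ℝ) J ∞ γ s ∧
    ∀ t ∈ s, covDerivAlong 𝓘(ℝ, ℝ) g γ (velocity J γ) t (1 : ℝ) = 0

/-- `f : M → N` is a smooth immersion. -/
def IsSmoothImmersion (I : ModelWithCorners ℝ E H) (J : ModelWithCorners ℝ E' H') (f : M → N) :
    Prop :=
  ContMDiff I J ∞ f ∧ ∀ p, Function.Injective (mfderiv I J f p)

/-- `V` is a smooth vector field of `N` along `f : M → N`. -/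
def IsSmoothAlong (I : ModelWithCorners ℝ E H) (J : ModelWithCorners ℝ E' H')
    [IsManifold J 1 N] (f : M → N)
    (V : ∀ p : M, TangentSpace J (f p)) : Prop :=
  ContMDiff I J.tangent ∞ (fun p => (⟨f p, V p⟩ : TangentBundle J N))

/-- `V` is a smooth vector field along the submanifold `f : M → N` which is parallel along `M`:
`∇_w V = 0` for every `w ∈ TM`. -/
def IsParallelAlong [IsManifold J 1 N] (I : ModelWithCorners ℝ E H) (g : MetricField J N) (f : M → N)
    (V : ∀ p : M, TangentSpace J (f p)) : Prop :=
  IsSmoothAlong I J f V ∧ ∀ (p : M) (w : TangentSpace I p), covDerivAlong I g f V p w = 0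

/-- The submanifold `f : M → N` is a helix submanifold of `(N, g)` with respect to `Y`: `Y` is
parallel along `M` and `h(p) = max {g(w, Y p) | w ∈ T_p M, g(w, w) = 1}` does not depend on `p`. -/
def IsHelix [IsManifold J 1 N] (I : ModelWithCorners ℝ E H) (g : MetricField J N) (f : M → N)
    (Y : ∀ p : M, TangentSpace J (f p)) : Prop :=
  IsParallelAlong I g f Y ∧
    ∃ c : ℝ, ∀ p : M, IsGreatest
      {r : ℝ | ∃ w : TangentSpace I p, g (f p) (mfderiv I J f p w) (mfderiv I J f p w) = 1 ∧
        r = g (f p) (mfderiv I J f p w) (Y p)} c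

/-- The submanifold `f : M → N` is totally geodesic: each geodesic of `M` with the induced metric is
a geodesic of `N`. -/
def IsTotallyGeodesic (I : ModelWithCorners ℝ E H) (g : MetricField J N) (f : M → N) : Prop :=
  ∀ (γ : ℝ → M) (s : Set ℝ), IsOpen s → s.OrdConnected →
    IsGeodesicOn (pullbackMetric I g f) γ s → IsGeodesicOn g (f ∘ γ) s

/-- The vector `Y` at `f p` is orthogonal to `M`. -/
def IsOrthogonalAt (I : ModelWithCorners ℝ E H) (g : MetricField J N) (f : M → N) (p : M)
    (Y : TangentSpace J (f p)) : Prop :=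
  ∀ w : TangentSpace I p, g (f p) Y (mfderiv I J f p w) = 0

/-- The vector `Y` at `f p` is tangent to `M`. -/
def IsTangentAt (I : ModelWithCorners ℝ E H) (f : M → N) (p : M)
    (Y : TangentSpace J (f p)) : Prop :=
  ∃ w : TangentSpace I p, mfderiv I J f p w = Y

/-- The vector `Y` at `f p` is transversal to `M`: the tangent space of `N` at `f p` is the direct
sum of `T_p M` and the line spanned by `Y`. -/
def IsTransversalAt (I : ModelWithCorners ℝ E H) (f : M → N) (p : M)
    (Y : TangentSpace J (f p)) : Prop :=
  (∀ v : TangentSpace J (f p), ∃ (w : TangentSpace I p) (a : ℝ), v = mfderiv I J f p w + a • Y) ∧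
    ¬ IsTangentAt I f p Y

/-- The tangential part `tan(Y)` of a vector field `Y` along `f : M → N`, as a vector field on `M`:
the vector of `T_p M` whose induced inner products with the vectors of `T_p M` are those of `Y`, so
that `Y - tan(Y)` is orthogonal to `M` (see `tangentialPart_spec`). -/
def tangentialPart (I : ModelWithCorners ℝ E H) (g : MetricField J N) (f : M → N)
    (Y : ∀ p : M, TangentSpace J (f p)) (p : M) : TangentSpace I p :=
  (pullbackMetric I g f p).inverse ((g (f p) (Y p)).comp (mfderiv I J f p))

theorem tangentialPart_spec [FiniteDimensional ℝ E] (g : MetricField J N)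
    (hg : ∀ x v, v ≠ 0 → 0 < g x v v) (f : M → N) (hf : IsSmoothImmersion I J f)
    (Y : ∀ p : M, TangentSpace J (f p)) (p : M) :
    IsOrthogonalAt I g f p (Y p - mfderiv I J f p (tangentialPart I g f Y p)) := by
  intro w
  have hpos : ∀ v : E, v ≠ 0 → 0 < pullbackMetric I g f p v v := fun v hv =>
    hg _ _ fun h0 => hv (hf.2 p (h0.trans (map_zero _).symm))
  have h := apply_inverse_of_pos (V := E) (pullbackMetric I g f p) hpos
    ((g (f p) (Y p)).comp (mfderiv I J f p))
  have h2 : pullbackMetric I g f p (tangentialPart I g f Y p) w =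
      g (f p) (Y p) (mfderiv I J f p w) := DFunLike.congr_fun h w
  rw [pullbackMetric_apply] at h2
  simp [h2]

/-- The Riemannian product metric `dt² + g₂` on `ℝ × M₂`. -/
def lineProductMetric (g : MetricField I M) : MetricField (𝓘(ℝ, ℝ).prod I) (ℝ × M) :=
  fun x =>
    pullbackMetric (𝓘(ℝ, ℝ).prod I) (riemannianMetricVectorSpace ℝ).inner Prod.fst x +
      pullbackMetric (𝓘(ℝ, ℝ).prod I) g Prod.snd x

/-- `(M, g)` is locally a Riemannian product `ℝ × M₂`: around each point there is an isometric
diffeomorphism from an open neighbourhood onto an open subset of a Riemannian product `ℝ × M₂`, for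
some Riemannian manifold `M₂` (which may depend on the point). -/
def IsLocallyLineProduct (g : MetricField I M) : Prop :=
  ∀ p : M, ∃ (m : ℕ) (M₂ : Type) (_ : TopologicalSpace M₂)
    (_ : ChartedSpace (EuclideanSpace ℝ (Fin m)) M₂) (_ : IsManifold (𝓡 m) ∞ M₂)
    (_ : T2Space M₂) (_ : SecondCountableTopology M₂)
    (g₂ : ContMDiffRiemannianMetric (𝓡 m) ∞ (EuclideanSpace ℝ (Fin m))
      (fun x : M₂ => TangentSpace (𝓡 m) x))
    (Φ : OpenPartialHomeomorph M (ℝ × M₂)),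
    p ∈ Φ.source ∧
      ContMDiffOn I (𝓘(ℝ, ℝ).prod (𝓡 m)) ∞ Φ Φ.source ∧
      ContMDiffOn (𝓘(ℝ, ℝ).prod (𝓡 m)) I ∞ Φ.symm Φ.target ∧
      ∀ q ∈ Φ.source, pullbackMetric I (lineProductMetric g₂.inner) Φ q = g q

end General

end HelixHypersurface

end

open Set Bundle
open scoped Manifold ContDiff Topology

noncomputable section

/-! Write T for tan(Y). Since Y is parallel and M is connected, |Y|² is constant
(`IsParallelAlong.metric_self_eq`). By Cauchy-Schwarz the helix function is |T|, so |T|² is constant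
as well (`IsHelix.exists_metric_tanPart`). The normal part of Y has squared length |Y|² - |T|², so
tangency or orthogonality at one point propagates to all of M, and so does their failure.

For (a) and (c), let γ be a geodesic of M along which g(γ', Y) is constant. By the Gauss formula
(`metric_covD_velocity_comp`) the ambient acceleration of γ is orthogonal to M; differentiating
g(γ', Y) shows that it is orthogonal to Y. In codimension one, TM and a non-tangent Y span TN, so
the acceleration vanishes (`IsGeodesicOn.comp_of_isParallelAlong`). In (a), T = 0 and g(γ', Y) = 0
for every γ; in (c), γ' = T and g(γ', Y) = |T|².

For (b), Y is tangent everywhere and has constant length √κ > 0. It lifts to a smooth field on M,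
which a flow box turns into ∂_s in coordinates (s, y) (`exists_straightening`). As ∇Y = 0, the
metric does not depend on s (the field is Killing), and the 1-form dual to ∂_s is closed, hence
equal to κ ds + dβ(y). Completing the square, the metric is (κ ds + dβ)²/κ + G(y)
(`exists_line_decomposition`), and t = √κ s + β/√κ makes it dt² + G.

The flow box rests on smooth dependence of flows on initial data, obtained here from the inverse
function theorem on the Banach space of continuous paths. -/

namespace HelixHypersurface

/-! ### Smoothness of superposition operators on spaces of continuous maps. -/

section Nemytskii

universe u

variable {K : Type*} [TopologicalSpace K] [CompactSpace K]

/-- The pointwise application of a continuous bilinear map to continuous maps. -/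
def pointwiseBilin (K : Type*) [TopologicalSpace K] [CompactSpace K]
    {G E F : Type*} [NormedAddCommGroup G] [NormedSpace ℝ G]
    [NormedAddCommGroup E] [NormedSpace ℝ E] [NormedAddCommGroup F] [NormedSpace ℝ F]
    (b : G →L[ℝ] E →L[ℝ] F) : C(K, G) →L[ℝ] C(K, E) →L[ℝ] C(K, F) :=
  LinearMap.mkContinuous₂
    (LinearMap.mk₂ ℝ
      (fun (A : C(K, G)) (u : C(K, E)) => (⟨fun k => b (A k) (u k), by fun_prop⟩ : C(K, F)))
      (fun _ _ _ => by ext; simp) (fun _ _ _ => by ext; simp)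
      (fun _ _ _ => by ext; simp) (fun _ _ _ => by ext; simp)) ‖b‖
    (fun (A : C(K, G)) (u : C(K, E)) => by
      rw [ContinuousMap.norm_le _ (by positivity)]
      intro k
      refine (b.le_opNorm₂ _ _).trans ?_
      gcongr
      · exact A.norm_coe_le_norm k
      · exact u.norm_coe_le_norm k)

@[simp] theorem pointwiseBilin_apply {G E F : Type*} [NormedAddCommGroup G] [NormedSpace ℝ G]
    [NormedAddCommGroup E] [NormedSpace ℝ E] [NormedAddCommGroup F] [NormedSpace ℝ F]
    (b : G →L[ℝ] E →L[ℝ] F) (A : C(K, G)) (u : C(K, E)) (k : K) :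
    pointwiseBilin K b A u k = b (A k) (u k) := rfl

-- The image of `u` is compact, so `V'` varies by at most ε within a uniform distance δ of it; the
-- mean value inequality then bounds the remainder uniformly in the point of `K`.
set_option synthInstance.maxHeartbeats 200000 in
theorem hasFDerivAt_comp_continuousMap {E F : Type*} [NormedAddCommGroup E] [NormedSpace ℝ E]
    [NormedAddCommGroup F] [NormedSpace ℝ F] {V : E → F} {V' : E → E →L[ℝ] F}
    (hV : ∀ x, HasFDerivAt V (V' x) x) (hc : Continuous V) (hc' : Continuous V') (u : C(K, E)) :
    HasFDerivAt (fun u : C(K, E) => (⟨V, hc⟩ : C(E, F)).comp u)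
      (pointwiseBilin K (ContinuousLinearMap.id ℝ (E →L[ℝ] F)) ((⟨V', hc'⟩ : C(E, E →L[ℝ] F)).comp u)) u := by
  rw [hasFDerivAt_iff_isLittleO_nhds_zero, Asymptotics.isLittleO_iff]
  intro ε hε
  have hK : IsCompact (range u) := isCompact_range u.continuous
  have h1 := hK.uniformContinuousAt_of_continuousAt V' (fun a _ => hc'.continuousAt)
    (Metric.dist_mem_uniformity hε)
  obtain ⟨δ, hδ, hδ'⟩ := Metric.mem_uniformity_dist.1 h1
  filter_upwards [Metric.ball_mem_nhds (0 : C(K, E)) hδ] with h hh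
  rw [ContinuousMap.norm_le _ (by positivity)]
  intro k
  have hk : ‖h k‖ < δ := (h.norm_coe_le_norm k).trans_lt (by simpa using hh)
  have h2 := (convex_ball (u k) δ).norm_image_sub_le_of_norm_hasFDerivWithin_le'
    (f := V) (f' := V') (φ := V' (u k)) (C := ε) (x := u k) (y := u k + h k)
    (fun x _ => (hV x).hasFDerivWithinAt)
    (fun x hx => by
      have := hδ' (a := u k) (b := x) (by rw [dist_comm]; exact hx) (mem_range_self k)
      rw [mem_ofPred_eq, dist_comm, dist_eq_norm] at this
      exact this.le)
    (Metric.mem_ball_self hδ) (by simpa [Metric.mem_ball, dist_eq_norm] using hk)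
  simp only [add_sub_cancel_left] at h2
  calc _ = ‖V (u k + h k) - V (u k) - (V' (u k)) (h k)‖ := rfl
    _ ≤ ε * ‖h k‖ := h2
    _ ≤ ε * ‖h‖ := by gcongr; exact h.norm_coe_le_norm k

-- The derivative is the superposition operator of `fderiv ℝ V` followed by a fixed bounded bilinear
-- pairing, which allows induction on the order. The target `F` is quantified inside the induction
-- because it becomes `E →L[ℝ] F`; this is why both spaces share a universe.
set_option synthInstance.maxHeartbeats 200000 in
theorem contDiff_comp_continuousMap_nat {E : Type u} [NormedAddCommGroup E] [NormedSpace ℝ E]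
    (n : ℕ) : ∀ {F : Type u} [NormedAddCommGroup F] [NormedSpace ℝ F] {V : E → F}
    (hc : Continuous V), ContDiff ℝ n V →
    ContDiff ℝ n (fun u : C(K, E) => (⟨V, hc⟩ : C(E, F)).comp u) := by
  induction n with
  | zero =>
    intro F _ _ V hc hV
    simp only [Nat.cast_zero, contDiff_zero]
    exact ContinuousMap.continuous_postcomp _
  | succ n ih =>
    intro F _ _ V hc hV
    have hV' : ContDiff ℝ n (fderiv ℝ V) := hV.fderiv_right (by norm_cast)
    rw [Nat.cast_add, Nat.cast_one, contDiff_succ_iff_hasFDerivAt]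
    refine ⟨_, (pointwiseBilin K (ContinuousLinearMap.id ℝ (E →L[ℝ] F))).contDiff.comp (ih hV'.continuous hV'), fun u => ?_⟩
    exact hasFDerivAt_comp_continuousMap
      (fun x => (hV.differentiable (by simp) x).hasFDerivAt) _ hV'.continuous u

/-- The superposition operator of a smooth map is smooth on spaces of continuous maps. -/
theorem contDiff_comp_continuousMap {E F : Type u} [NormedAddCommGroup E] [NormedSpace ℝ E]
    [NormedAddCommGroup F] [NormedSpace ℝ F] {V : E → F} (hV : ContDiff ℝ ∞ V) :
    ContDiff ℝ ∞ (fun u : C(K, E) => (⟨V, hV.continuous⟩ : C(E, F)).comp u) :=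
  contDiff_infty.2 fun n => contDiff_comp_continuousMap_nat n _ (contDiff_infty.1 hV n)

end Nemytskii

/-! ### Inverse function theorem with a smooth inverse on an open set. -/

section Inverse

/-- Invertibility of the derivative is an open condition, so after shrinking the source the inverse
is smooth at every point of the target and not only at the image of `x`. -/
theorem exists_smooth_local_inverse {E F : Type*} [NormedAddCommGroup E] [NormedSpace ℝ E]
    [CompleteSpace E] [NormedAddCommGroup F] [NormedSpace ℝ F] [CompleteSpace F]
    {f : E → F} {U : Set E} (hU : IsOpen U) (hf : ContDiffOn ℝ ∞ f U) {x : E} (hx : x ∈ U)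
    (f' : E ≃L[ℝ] F) (hf' : HasFDerivAt f (f' : E →L[ℝ] F) x) :
    ∃ e : OpenPartialHomeomorph E F, x ∈ e.source ∧ e.source ⊆ U ∧ (e : E → F) = f ∧
      ContDiffOn ℝ ∞ e.symm e.target := by
  have hfx : ContDiffAt ℝ ∞ f x := hf.contDiffAt (hU.mem_nhds hx)
  let e₀ := hfx.toOpenPartialHomeomorph f hf' (by simp)
  have h1 : ContinuousAt (fderiv ℝ f) x := hfx.continuousAt_fderiv (by simp)
  have h2 : ∀ᶠ y in 𝓝 x, fderiv ℝ f y ∈ range ((↑) : (E ≃L[ℝ] F) → E →L[ℝ] F) := by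
    apply h1
    rw [hf'.fderiv]
    exact ContinuousLinearEquiv.nhds f'
  obtain ⟨W, hW, hWo, hxW⟩ := mem_nhds_iff.1 (h2.and (hU.mem_nhds hx))
  refine ⟨e₀.restrOpen W hWo, ⟨hfx.mem_toOpenPartialHomeomorph_source hf' _, hxW⟩,
    fun y hy => (hW hy.2).2, rfl, fun y hy => ?_⟩
  have hy' := (e₀.restrOpen W hWo).map_target hy
  obtain ⟨A, hA⟩ := (hW hy'.2).1
  have hyU := (hW hy'.2).2
  refine ((e₀.restrOpen W hWo).contDiffAt_symm (f₀' := A) hy ?_ ?_).contDiffWithinAt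
  · rw [hA]
    exact ((hf.contDiffAt (hU.mem_nhds hyU)).differentiableAt (by simp)).hasFDerivAt
  · exact hf.contDiffAt (hU.mem_nhds hyU)

end Inverse

/-! ### Smooth local flows by the inverse function theorem on path space. -/

section Flow

universe u

variable {E : Type u} [NormedAddCommGroup E] [NormedSpace ℝ E]

theorem norm_integral_projIcc_le (u : C(Icc (0 : ℝ) 1, E)) (t : Icc (0 : ℝ) 1) :
    ‖∫ r in (0 : ℝ)..t, u (projIcc 0 1 zero_le_one r)‖ ≤ ‖u‖ := by
  refine (intervalIntegral.norm_integral_le_of_norm_le_const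
    (fun r _ => u.norm_coe_le_norm _)).trans ?_
  rw [sub_zero, abs_of_nonneg t.2.1]
  exact mul_le_of_le_one_right (norm_nonneg _) t.2.2

/-- The Volterra operator `u ↦ (t ↦ ∫₀ᵗ u)` on continuous maps on the unit interval. -/
def volterra (E : Type u) [NormedAddCommGroup E] [NormedSpace ℝ E] :
    C(Icc (0 : ℝ) 1, E) →L[ℝ] C(Icc (0 : ℝ) 1, E) :=
  LinearMap.mkContinuous
    { toFun := fun u => ⟨fun t => ∫ r in (0 : ℝ)..t, u (projIcc 0 1 zero_le_one r),
        (intervalIntegral.continuous_primitive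
          (fun a b => (u.continuous.comp continuous_projIcc).intervalIntegrable a b) 0).comp
          continuous_subtype_val⟩
      map_add' := fun u v => by
        ext t
        exact intervalIntegral.integral_add
          ((u.continuous.comp continuous_projIcc).intervalIntegrable _ _)
          ((v.continuous.comp continuous_projIcc).intervalIntegrable _ _)
      map_smul' := fun c u => by
        ext t
        exact intervalIntegral.integral_smul c _ } 1
    (fun u => by
      rw [one_mul, ContinuousMap.norm_le _ (norm_nonneg _)]
      exact norm_integral_projIcc_le u)

theorem volterra_apply (u : C(Icc (0 : ℝ) 1, E)) (t : Icc (0 : ℝ) 1) :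
    volterra E u t = ∫ r in (0 : ℝ)..t, u (projIcc 0 1 zero_le_one r) := rfl

/-- Multiplication by `τ ∈ [0, 1]` on the unit interval. -/
def unitScale (τ : Icc (0 : ℝ) 1) : C(Icc (0 : ℝ) 1, Icc (0 : ℝ) 1) :=
  ⟨fun t => ⟨τ * t, mul_nonneg τ.2.1 t.2.1, mul_le_one₀ τ.2.2 t.2.1 t.2.2⟩, by fun_prop⟩

/-- This is the substitution r ↦ τ r in the integral. -/
theorem volterra_comp_unitScale (u : C(Icc (0 : ℝ) 1, E)) (τ : Icc (0 : ℝ) 1) :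
    (volterra E u).comp (unitScale τ) = (τ : ℝ) • volterra E (u.comp (unitScale τ)) := by
  ext t
  have h1 : ((volterra E u).comp (unitScale τ)) t =
      ∫ r in (0 : ℝ)..(τ * t), u (projIcc 0 1 zero_le_one r) := rfl
  have h2 : ((τ : ℝ) • volterra E (u.comp (unitScale τ))) t =
      (τ : ℝ) • ∫ r in (0 : ℝ)..t, u (projIcc 0 1 zero_le_one (τ * r)) := by
    rw [ContinuousMap.smul_apply, volterra_apply]
    congr 1
    refine intervalIntegral.integral_congr fun r hr => ?_
    rw [uIcc_of_le t.2.1] at hr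
    have hr' : r ∈ Icc (0 : ℝ) 1 := ⟨hr.1, hr.2.trans t.2.2⟩
    have hr'' : (τ : ℝ) * r ∈ Icc (0 : ℝ) 1 :=
      ⟨mul_nonneg τ.2.1 hr.1, mul_le_one₀ τ.2.2 hr.1 hr'.2⟩
    simp only [ContinuousMap.comp_apply, projIcc_of_mem _ hr', projIcc_of_mem _ hr'']
    rfl
  rw [h1, h2, intervalIntegral.smul_integral_comp_mul_left
    (fun r => u (projIcc 0 1 zero_le_one r)), mul_zero]

/-- The superposition operator on continuous maps on the unit interval. -/
def superpose {V : E → E} (hV : Continuous V) (u : C(Icc (0 : ℝ) 1, E)) : C(Icc (0 : ℝ) 1, E) :=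
  (⟨V, hV⟩ : C(E, E)).comp u

/-- The constant maps, as a continuous linear map. -/
def constCLM (E : Type u) [NormedAddCommGroup E] [NormedSpace ℝ E] :
    E →L[ℝ] C(Icc (0 : ℝ) 1, E) :=
  LinearMap.mkContinuous
    { toFun := ContinuousMap.const _
      map_add' := fun _ _ => rfl
      map_smul' := fun _ _ => rfl } 1
    (fun x => by
      rw [one_mul, ContinuousMap.norm_le _ (norm_nonneg _)]
      exact fun _ => le_rfl)

/-- The map whose zeros are the integral curves of `V`, in the form: `u` is a zero at `(s, x)` if
`x + u` solves the equation `y' = s V(y)` on the unit interval with `y(0) = x`. -/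
def flowDefect {V : E → E} (hV : Continuous V) (p : (ℝ × E) × C(Icc (0 : ℝ) 1, E)) :
    C(Icc (0 : ℝ) 1, E) :=
  p.2 - p.1.1 • volterra E (superpose hV (constCLM E p.1.2 + p.2))

theorem contDiff_flowDefect {V : E → E} (hV : ContDiff ℝ ∞ V) :
    ContDiff ℝ ∞ (flowDefect hV.continuous) := by
  have h1 : ContDiff ℝ ∞ (superpose hV.continuous) := contDiff_comp_continuousMap hV
  have h2 : ContDiff ℝ ∞ (fun p : (ℝ × E) × C(Icc (0 : ℝ) 1, E) => constCLM E p.1.2 + p.2) :=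
    ((constCLM E).contDiff.comp (contDiff_snd.comp contDiff_fst)).add contDiff_snd
  exact contDiff_snd.sub ((contDiff_fst.comp contDiff_fst).smul
    ((volterra E).contDiff.comp (h1.comp h2)))

/-- The shear `(a, w) ↦ (a, w - a₁ c)`. -/
def shearEquiv {W : Type*} [NormedAddCommGroup W] [NormedSpace ℝ W] (c : W) :
    ((ℝ × E) × W) ≃L[ℝ] ((ℝ × E) × W) :=
  let A : (ℝ × E) →L[ℝ] W := (ContinuousLinearMap.fst ℝ ℝ E).smulRight c
  let p₁ := ContinuousLinearMap.fst ℝ (ℝ × E) W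
  let p₂ := ContinuousLinearMap.snd ℝ (ℝ × E) W
  ContinuousLinearEquiv.equivOfInverse (p₁.prod (p₂ - A.comp p₁)) (p₁.prod (p₂ + A.comp p₁))
    (fun x => by simp [p₁, p₂, A]) (fun x => by simp [p₁, p₂, A])

/-- At s = 0 the factor s kills the derivative of the integral term, so only its s-derivative
survives. The total derivative is therefore a shear, which is invertible. -/
theorem hasFDerivAt_flowDefect [CompleteSpace E] {V : E → E} (hV : ContDiff ℝ ∞ V) (x₀ : E) :
    HasFDerivAt (fun p : (ℝ × E) × C(Icc (0 : ℝ) 1, E) => (p.1, flowDefect hV.continuous p))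
      (shearEquiv (E := E) (volterra E (superpose hV.continuous (constCLM E x₀))) :
        ((ℝ × E) × C(Icc (0 : ℝ) 1, E)) →L[ℝ] ((ℝ × E) × C(Icc (0 : ℝ) 1, E))) ((0, x₀), 0) := by
  refine hasFDerivAt_fst.prodMk ?_
  have h1 : ContDiff ℝ ∞ (superpose hV.continuous) := contDiff_comp_continuousMap hV
  have h2 : ContDiff ℝ ∞ (fun p : (ℝ × E) × C(Icc (0 : ℝ) 1, E) => constCLM E p.1.2 + p.2) :=
    ((constCLM E).contDiff.comp (contDiff_snd.comp contDiff_fst)).add contDiff_snd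
  have h3 := ((volterra E).contDiff.comp (h1.comp h2)).differentiable (by simp) ((0, x₀), 0)
  have h4 : HasFDerivAt (fun p : (ℝ × E) × C(Icc (0 : ℝ) 1, E) => p.1.1)
      ((ContinuousLinearMap.fst ℝ ℝ E).comp (ContinuousLinearMap.fst ℝ _ _)) ((0, x₀), 0) :=
    ((ContinuousLinearMap.fst ℝ ℝ E).comp (ContinuousLinearMap.fst ℝ (ℝ × E)
      C(Icc (0 : ℝ) 1, E))).hasFDerivAt
  have h5 := hasFDerivAt_snd.sub (h4.smul h3.hasFDerivAt)
  refine h5.congr_fderiv ?_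
  ext p
  all_goals simp

/-- Zeros of the flow defect satisfy the differential equation. -/
theorem hasDerivWithinAt_of_flowDefect_eq_zero [CompleteSpace E] {V : E → E} (hV : Continuous V)
    {s : ℝ} {x : E} {u : C(Icc (0 : ℝ) 1, E)} (h : flowDefect hV ((s, x), u) = 0) :
    HasDerivWithinAt (fun τ : ℝ => x + u (projIcc 0 1 zero_le_one τ))
      (s • V (x + u 1)) (Icc 0 1) 1 := by
  have hu : u = s • volterra E (superpose hV (constCLM E x + u)) := sub_eq_zero.1 h
  have hc : Continuous (fun r : ℝ => V (x + u (projIcc 0 1 zero_le_one r))) := by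
    have := u.continuous.comp (continuous_projIcc (h := zero_le_one (α := ℝ)))
    fun_prop
  have h1 : HasDerivAt (fun τ : ℝ => x + s • ∫ r in (0 : ℝ)..τ,
      V (x + u (projIcc 0 1 zero_le_one r))) (s • V (x + u (projIcc 0 1 zero_le_one 1))) 1 :=
    ((intervalIntegral.integral_hasDerivAt_right (hc.intervalIntegrable _ _)
      hc.stronglyMeasurable.stronglyMeasurableAtFilter hc.continuousAt).const_smul s).const_add x
  have h2 : projIcc (0 : ℝ) 1 zero_le_one 1 = 1 := projIcc_right _
  rw [h2] at h1
  have key : ∀ τ ∈ Icc (0 : ℝ) 1, x + u (projIcc 0 1 zero_le_one τ) = x + s • ∫ r in (0 : ℝ)..τ,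
      V (x + u (projIcc 0 1 zero_le_one r)) := by
    intro τ hτ
    congr 1
    conv_lhs => rw [hu, projIcc_of_mem _ hτ]
    rfl
  exact h1.hasDerivWithinAt.congr key (key 1 (by simp))

/-- A solution of y' = sV(y) run only up to time τ and rescaled to [0, 1] solves y' = τsV(y). This
converts the path variable τ into the flow time s. -/
theorem flowDefect_unitScale {V : E → E} (hV : Continuous V)
    {s : ℝ} {x : E} {u : C(Icc (0 : ℝ) 1, E)} (h : flowDefect hV ((s, x), u) = 0)
    (τ : Icc (0 : ℝ) 1) : flowDefect hV ((τ * s, x), u.comp (unitScale τ)) = 0 := by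
  have hu : u = s • volterra E (superpose hV (constCLM E x + u)) := sub_eq_zero.1 h
  refine sub_eq_zero.2 ?_
  have h1 : superpose hV (constCLM E x + u.comp (unitScale τ)) =
      (superpose hV (constCLM E x + u)).comp (unitScale τ) := rfl
  change u.comp (unitScale τ) = (τ * s) • volterra E (superpose hV (constCLM E x + _))
  rw [h1, mul_comm, mul_smul, ← volterra_comp_unitScale]
  conv_lhs => rw [hu]
  rfl

/-- A smooth vector field on a Banach space has a smooth local flow. -/
theorem exists_smooth_flow [CompleteSpace E] {V : E → E} (hV : ContDiff ℝ ∞ V) (x₀ : E) :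
    ∃ (D : Set (ℝ × E)) (Φ : ℝ × E → E), IsOpen D ∧ (0, x₀) ∈ D ∧ ContDiffOn ℝ ∞ Φ D ∧
      (∀ x, (0, x) ∈ D → Φ (0, x) = x) ∧ ∀ z ∈ D, fderiv ℝ Φ z (1, 0) = V (Φ z) := by
  obtain ⟨e, hxe, -, hef, hes⟩ := exists_smooth_local_inverse isOpen_univ
    (contDiff_fst.prodMk (contDiff_flowDefect hV)).contDiffOn
    (mem_univ ((0, x₀), 0)) _ (hasFDerivAt_flowDefect hV x₀)
  obtain ⟨δ, hδ, hbox⟩ := Metric.isOpen_iff.1 e.open_source _ hxe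
  rw [← ball_prod_same, ← ball_prod_same] at hbox
  have hx0 : e ((0, x₀), 0) = ((0, x₀), 0) := by
    rw [hef]; simp [flowDefect]
  set box : Set ((ℝ × E) × C(Icc (0 : ℝ) 1, E)) :=
    (Metric.ball 0 δ ×ˢ Metric.ball x₀ δ) ×ˢ Metric.ball 0 δ with hboxdef
  have hboxo : IsOpen box := (Metric.isOpen_ball.prod Metric.isOpen_ball).prod Metric.isOpen_ball
  -- The path over `z` is the preimage of `(z, 0)`. Requiring it to lie in the product box keeps all
  -- its rescalings in `e.source`, where `e` is injective.
  set D : Set (ℝ × E) := (fun z => (z, (0 : C(Icc (0 : ℝ) 1, E)))) ⁻¹' (e.target ∩ e.symm ⁻¹' box)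
  have hDo : IsOpen D := (e.isOpen_inter_preimage_symm hboxo).preimage (by fun_prop)
  let U : ℝ × E → C(Icc (0 : ℝ) 1, E) := fun z => (e.symm (z, 0)).2
  have hU : ∀ z ∈ D, e.symm (z, 0) = (z, U z) ∧ flowDefect hV.continuous (z, U z) = 0 := by
    intro z hz
    have h1 := e.right_inv hz.1
    rw [hef] at h1
    have h2 : (e.symm (z, 0)).1 = z := congrArg Prod.fst h1
    have h3 : e.symm (z, 0) = (z, U z) := Prod.ext h2 rfl
    refine ⟨h3, ?_⟩
    rw [← h3]
    exact congrArg Prod.snd h1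
  have hUs : ContDiffOn ℝ ∞ U D :=
    (contDiff_snd.comp_contDiffOn hes).comp
      (contDiff_id.prodMk contDiff_const).contDiffOn (fun z hz => hz.1)
  let Φ : ℝ × E → E := fun z => z.2 + U z 1
  have hev : ContDiff ℝ ∞ (fun u : C(Icc (0 : ℝ) 1, E) => u 1) :=
    ContinuousLinearMap.contDiff (ContinuousMap.evalCLM (M := E) ℝ (1 : Icc (0 : ℝ) 1))
  have hΦs : ContDiffOn ℝ ∞ Φ D :=
    contDiff_snd.contDiffOn.add (hev.comp_contDiffOn hUs)
  have hmain : ∀ z ∈ D, z.1 ≠ 0 → fderiv ℝ Φ z (1, 0) = V (Φ z) := by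
    rintro ⟨s, x⟩ hz hs
    obtain ⟨h1, h2⟩ := hU _ hz
    have hb : ((s, x), U (s, x)) ∈ box := h1 ▸ hz.2
    -- The rescaled path is a zero of the defect inside the box, so by injectivity of `e` it is the
    -- path that defines `Φ (τ * s, x)`.
    have key : ∀ τ ∈ Icc (0 : ℝ) 1, Φ (τ * s, x) = x + U (s, x) (projIcc 0 1 zero_le_one τ) := by
      intro τ hτ
      have h3 := flowDefect_unitScale hV.continuous h2 ⟨τ, hτ⟩
      have h4 : ((τ * s, x), (U (s, x)).comp (unitScale ⟨τ, hτ⟩)) ∈ e.source := by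
        refine hbox ⟨⟨?_, hb.1.2⟩, ?_⟩
        · have := hb.1.1
          simp only [mem_ball_zero_iff, norm_mul] at this ⊢
          refine lt_of_le_of_lt (mul_le_of_le_one_left (norm_nonneg _) ?_) this
          rw [Real.norm_eq_abs, abs_of_nonneg hτ.1]; exact hτ.2
        · have := hb.2
          simp only [mem_ball_zero_iff] at this ⊢
          refine lt_of_le_of_lt ?_ this
          rw [ContinuousMap.norm_le _ (norm_nonneg _)]
          exact fun t => (U (s, x)).norm_coe_le_norm _
      have h5 := e.left_inv h4
      rw [hef] at h5
      simp only [h3] at h5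
      have h6 : U (τ * s, x) = (U (s, x)).comp (unitScale ⟨τ, hτ⟩) := by
        change (e.symm ((τ * s, x), 0)).2 = _
        rw [h5]
      change x + U (τ * s, x) 1 = _
      rw [h6, projIcc_of_mem _ hτ]
      have h7 : unitScale ⟨τ, hτ⟩ 1 = ⟨τ, hτ⟩ := by ext; simp [unitScale]
      rw [ContinuousMap.comp_apply, h7]
    have h7 := hasDerivWithinAt_of_flowDefect_eq_zero hV.continuous h2
    have h8 : HasDerivAt (fun τ : ℝ => Φ (τ * s, x)) (fderiv ℝ Φ (s, x) (s, 0)) 1 := by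
      have h9 : HasFDerivAt Φ (fderiv ℝ Φ (s, x)) (1 * s, x) := by
        rw [one_mul]
        exact ((hΦs.contDiffAt (hDo.mem_nhds hz)).differentiableAt (by simp)).hasFDerivAt
      have h10 : HasDerivAt (fun τ : ℝ => (τ * s, x)) ((s, 0) : ℝ × E) 1 := by
        simpa using ((hasDerivAt_id (1 : ℝ)).mul_const s).prodMk (hasDerivAt_const (1 : ℝ) x)
      exact h9.comp_hasDerivAt 1 h10
    -- Both sides are one-sided derivatives at τ = 1 of the same function; the factor s cancels
    -- afterwards because s ≠ 0.
    have h11 : fderiv ℝ Φ (s, x) (s, 0) = s • V (x + U (s, x) 1) :=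
      (uniqueDiffOn_Icc zero_lt_one 1 (by simp)).eq_deriv _
        (h8.hasDerivWithinAt.congr (fun τ hτ => (key τ hτ).symm) (key 1 (by simp)).symm) h7
    have h12 : ((s, 0) : ℝ × E) = s • (1, 0) := by simp
    rw [h12, map_smul] at h11
    exact smul_right_injective E hs h11
  refine ⟨D, Φ, hDo, ⟨?_, ?_⟩, hΦs, ?_, ?_⟩
  · simpa [hx0] using e.map_source hxe
  · have := e.left_inv hxe
    rw [hx0] at this
    change e.symm ((0, x₀), 0) ∈ box
    rw [this]
    simp [hboxdef, hδ]
  · intro x hx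
    have h1 := (hU _ hx).2
    have h2 : U (0, x) = 0 := by simpa [flowDefect] using h1
    simp [Φ, h2]
  · rintro ⟨s, x⟩ hz
    rcases ne_or_eq s 0 with hs | rfl
    · exact hmain _ hz hs
    -- At time 0 rescaling carries no information; the equation follows by continuity from nonzero
    -- times.
    have hc1 : ContinuousAt (fun r : ℝ => fderiv ℝ Φ (r, x) (1, 0) - V (Φ (r, x))) 0 := by
      have h1 : ContinuousAt (fun r : ℝ => (r, x)) 0 := by fun_prop
      have h2 := hΦs.contDiffAt (hDo.mem_nhds hz)
      refine ContinuousAt.sub ?_ ?_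
      · exact (ContinuousAt.comp (f := fun r : ℝ => (r, x)) (x := 0) (g := fderiv ℝ Φ) (h2.continuousAt_fderiv (by simp)) h1).clm_apply
          continuousAt_const
      · exact hV.continuous.continuousAt.comp
          (ContinuousAt.comp (f := fun r : ℝ => (r, x)) (x := 0) (g := Φ) h2.continuousAt h1)
    have hev : ∀ᶠ r in 𝓝[≠] (0 : ℝ), fderiv ℝ Φ (r, x) (1, 0) - V (Φ (r, x)) = 0 := by
      have h1 : ∀ᶠ r in 𝓝 (0 : ℝ), (r, x) ∈ D :=
        ContinuousAt.preimage_mem_nhds (f := fun r : ℝ => (r, x)) (by fun_prop) (hDo.mem_nhds hz)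
      filter_upwards [h1.filter_mono nhdsWithin_le_nhds, self_mem_nhdsWithin] with r hr hr0
      exact sub_eq_zero.2 (hmain _ hr hr0)
    have h3 := hc1.tendsto.mono_left (nhdsWithin_le_nhds (s := {0}ᶜ))
    have h4 : Filter.Tendsto (fun r : ℝ => fderiv ℝ Φ (r, x) (1, 0) - V (Φ (r, x))) (𝓝[≠] 0)
      (𝓝 0) := tendsto_const_nhds.congr' (hev.mono fun _ h => h.symm)
    exact sub_eq_zero.1 (tendsto_nhds_unique h3 h4)

end Flow

/-! ### Straightening a nonvanishing vector field. -/

section FlowBox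

universe u

variable {E : Type u} [NormedAddCommGroup E] [NormedSpace ℝ E] [FiniteDimensional ℝ E]

/-- A vector field which is smooth near a point agrees near the point with a smooth one. -/
theorem exists_smooth_extension {V : E → E} {U : Set E} (hU : IsOpen U) (hV : ContDiffOn ℝ ∞ V U)
    {x₀ : E} (hx₀ : x₀ ∈ U) :
    ∃ (W : E → E) (O : Set E), ContDiff ℝ ∞ W ∧ IsOpen O ∧ x₀ ∈ O ∧ O ⊆ U ∧ EqOn W V O := by
  obtain ⟨r, hr, hrU⟩ := Metric.isOpen_iff.1 hU x₀ hx₀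
  let χ : ContDiffBump x₀ := ⟨r / 4, r / 2, by positivity, by linarith⟩
  refine ⟨fun x => χ x • V x, Metric.ball x₀ (r / 4), ?_, Metric.isOpen_ball,
    Metric.mem_ball_self (by positivity),
    (Metric.ball_subset_ball (by linarith)).trans hrU, ?_⟩
  · rw [contDiff_iff_contDiffAt]
    intro x
    by_cases hx : x ∈ Metric.closedBall x₀ (r / 2)
    · have hxU : x ∈ U := hrU (Metric.closedBall_subset_ball (by linarith) hx)
      exact χ.contDiff.contDiffAt.smul (hV.contDiffAt (hU.mem_nhds hxU))
    · refine (contDiffAt_const (c := (0 : E))).congr_of_eventuallyEq ?_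
      filter_upwards [Metric.isClosed_closedBall.isOpen_compl.mem_nhds hx] with y hy
      have : χ y = 0 := by
        apply χ.zero_of_le_dist
        simp only [mem_compl_iff, Metric.mem_closedBall, not_le] at hy
        exact hy.le
      simp [this]
  · intro x hx
    have : χ x = 1 := χ.one_of_mem_closedBall (Metric.ball_subset_closedBall hx)
    simp [this]

/-- Straightening of a nowhere vanishing vector field. -/
theorem exists_flowBox {F : Type*} [NormedAddCommGroup F] [InnerProductSpace ℝ F]
    [FiniteDimensional ℝ F]
    (hEF : Module.finrank ℝ E = Module.finrank ℝ F + 1) {V : E → E} {U : Set E} (hU : IsOpen U)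
    (hV : ContDiffOn ℝ ∞ V U) {x₀ : E} (hx₀ : x₀ ∈ U) (hVx₀ : V x₀ ≠ 0) :
    ∃ (Ψ : OpenPartialHomeomorph (ℝ × F) E) (ε : ℝ), 0 < ε ∧ Ψ.source = Ioo (-ε) ε ×ˢ univ ∧
      x₀ ∈ Ψ.target ∧ Ψ.target ⊆ U ∧ ContDiffOn ℝ ∞ Ψ Ψ.source ∧
      ContDiffOn ℝ ∞ Ψ.symm Ψ.target ∧
      ∀ z ∈ Ψ.source, fderiv ℝ Ψ z (1, 0) = V (Ψ z) := by
  obtain ⟨W, O, hW, hO, hx₀O, hOU, hWV⟩ := exists_smooth_extension hU hV hx₀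
  obtain ⟨D, Φ, hD, hxD, hΦ, hΦ0, hΦ'⟩ := exists_smooth_flow hW x₀
  -- a linear isomorphism sending `(1, 0)` to `V x₀`
  obtain ⟨A, hA⟩ : ∃ A : (ℝ × F) ≃L[ℝ] E, A (1, 0) = V x₀ := by
    have hfr : Module.finrank ℝ (ℝ × F) = Module.finrank ℝ E := by
      rw [hEF, Module.finrank_prod, Module.finrank_self, add_comm]
    let B : (ℝ × F) ≃L[ℝ] E := ContinuousLinearEquiv.ofFinrankEq hfr
    have hne : B (1, 0) ≠ 0 := by
      intro h
      have := B.injective (h.trans (map_zero B).symm)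
      simp at this
    obtain ⟨C, hC⟩ := SeparatingDual.exists_continuousLinearEquiv_apply_eq (R := ℝ) hne hVx₀
    exact ⟨B.trans C, hC⟩
  -- The flow starts on the affine slice `x₀ + A (0, ·)`, which is transversal to `V x₀ = A (1, 0)`;
  -- hence `Φ ∘ κ` has derivative `A` at 0.
  let κ : ℝ × F → ℝ × E := fun z => (z.1, x₀ + A (0, z.2))
  have hκ : ContDiff ℝ ∞ κ := by
    refine contDiff_fst.prodMk (contDiff_const.add (A.contDiff.comp ?_))
    exact contDiff_const.prodMk contDiff_snd
  have hκ0 : κ 0 = (0, x₀) := by simp [κ]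
  have hΨs : ContDiffOn ℝ ∞ (Φ ∘ κ) (κ ⁻¹' D) := hΦ.comp hκ.contDiffOn fun _ h => h
  have hDκ : IsOpen (κ ⁻¹' D) := hD.preimage hκ.continuous
  have hO' : IsOpen (κ ⁻¹' D ∩ (Φ ∘ κ) ⁻¹' O) := hΨs.continuousOn.isOpen_inter_preimage hDκ hO
  have h0 : (0 : ℝ × F) ∈ κ ⁻¹' D ∩ (Φ ∘ κ) ⁻¹' O := by
    refine ⟨?_, ?_⟩
    · rw [mem_preimage, hκ0]; exact hxD
    · rw [mem_preimage, Function.comp_apply, hκ0, hΦ0 _ hxD]; exact hx₀O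
  have hdκ : ∀ z, HasFDerivAt κ ((ContinuousLinearMap.fst ℝ ℝ F).prod
      ((A : (ℝ × F) →L[ℝ] E).comp ((0 : (ℝ × F) →L[ℝ] ℝ).prod (ContinuousLinearMap.snd ℝ ℝ F)))) z := by
    intro z
    refine hasFDerivAt_fst.prodMk (HasFDerivAt.const_add _ ?_)
    exact A.hasFDerivAt.comp z ((hasFDerivAt_const (0 : ℝ) z).prodMk hasFDerivAt_snd)
  have hdΨ : HasFDerivAt (Φ ∘ κ) (A : (ℝ × F) →L[ℝ] E) 0 := by
    have h1 : HasFDerivAt Φ (fderiv ℝ Φ (0, x₀)) (κ 0) := by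
      rw [hκ0]
      exact ((hΦ.contDiffAt (hD.mem_nhds hxD)).differentiableAt (by simp)).hasFDerivAt
    refine (h1.comp 0 (hdκ 0)).congr_fderiv ?_
    have h2 : ∀ w, fderiv ℝ Φ (0, x₀) (0, w) = w := by
      intro w
      have h3 : HasFDerivAt (fun x : E => Φ (0, x))
          ((fderiv ℝ Φ (0, x₀)).comp (ContinuousLinearMap.inr ℝ ℝ E)) x₀ := by
        rw [hκ0] at h1
        exact h1.comp x₀ ((hasFDerivAt_const (0 : ℝ) x₀).prodMk (hasFDerivAt_id x₀))
      have h4 : (fun x : E => Φ (0, x)) =ᶠ[𝓝 x₀] id := by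
        have : ∀ᶠ x in 𝓝 x₀, ((0 : ℝ), x) ∈ D :=
          ContinuousAt.preimage_mem_nhds (f := fun x : E => ((0 : ℝ), x)) (by fun_prop)
            (hD.mem_nhds hxD)
        exact this.mono fun x hx => hΦ0 x hx
      have h5 := h3.unique ((hasFDerivAt_id x₀).congr_of_eventuallyEq h4)
      exact DFunLike.congr_fun h5 w
    have h6 : fderiv ℝ Φ (0, x₀) (1, 0) = V x₀ := by
      rw [hΦ' _ hxD, hΦ0 _ hxD, hWV hx₀O]
    ext z
    · have h7 : A ((0 : ℝ), (0 : F)) = 0 := map_zero A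
      simp [h6, hA, h7]
    · simp [h2]
  obtain ⟨e, he0, heU, hef, hes⟩ := exists_smooth_local_inverse hO'
    (hΨs.mono inter_subset_left) h0 A hdΨ
  obtain ⟨ε, hε, hbox⟩ := Metric.isOpen_iff.1 e.open_source _ he0
  have hbox' : Ioo (-ε) ε ×ˢ Metric.ball (0 : F) ε ⊆ e.source := by
    have h1 : Metric.ball (0 : ℝ × F) ε = Metric.ball (0 : ℝ) ε ×ˢ Metric.ball (0 : F) ε :=
      (ball_prod_same _ _ _).symm
    rwa [h1, Real.ball_eq_Ioo, zero_sub, zero_add] at hbox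
  -- The ball of the slice is reparametrised by all of `F`, so that the transversal factor is a
  -- whole vector space: closed 1-forms on it are exact, and it can serve as the second factor of
  -- the product.
  let b : OpenPartialHomeomorph (ℝ × F) (ℝ × F) :=
    (OpenPartialHomeomorph.ofSet (Ioo (-ε) ε) isOpen_Ioo).prod
      (OpenPartialHomeomorph.univBall (0 : F) ε)
  have hbs : b.source = Ioo (-ε) ε ×ˢ univ := by simp [b]
  have hbt : b.target = Ioo (-ε) ε ×ˢ Metric.ball (0 : F) ε := by
    simp [b, OpenPartialHomeomorph.univBall_target _ hε]
  have hb : ∀ z, b z = (z.1, OpenPartialHomeomorph.univBall (0 : F) ε z.2) := fun z => rfl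
  have hbsm : ContDiff ℝ ∞ b :=
    contDiff_fst.prodMk (OpenPartialHomeomorph.contDiff_univBall.comp contDiff_snd)
  have hbsym : ContDiffOn ℝ ∞ b.symm b.target := by
    have h1 : ContDiffOn ℝ ∞ (OpenPartialHomeomorph.univBall (0 : F) ε).symm (Metric.ball 0 ε) :=
      OpenPartialHomeomorph.contDiffOn_univBall_symm
    rw [hbt]
    exact contDiff_fst.contDiffOn.prodMk (h1.comp contDiff_snd.contDiffOn fun z hz => hz.2)
  have hsrc : (b.trans e).source = Ioo (-ε) ε ×ˢ univ := by
    rw [OpenPartialHomeomorph.trans_source, hbs, inter_eq_left]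
    intro z hz
    refine hbox' ?_
    rw [← hbt]
    exact b.map_source (by rw [hbs]; exact hz)
  have hzs : ∀ z ∈ (b.trans e).source, b z ∈ κ ⁻¹' D ∩ (Φ ∘ κ) ⁻¹' O := by
    intro z hz
    rw [OpenPartialHomeomorph.trans_source] at hz
    exact heU hz.2
  have htgt : ∀ y ∈ (b.trans e).target, y ∈ e.target ∧ e.symm y ∈ b.target := by
    intro y hy
    rw [OpenPartialHomeomorph.trans_target] at hy
    exact hy
  refine ⟨b.trans e, ε, hε, hsrc, ?_, ?_, ?_, ?_, ?_⟩
  · have h1 : (0 : ℝ × F) ∈ (b.trans e).source := by rw [hsrc]; simp [hε]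
    have h2 := (b.trans e).map_source h1
    have h3 : (b.trans e) 0 = x₀ := by
      have h4 : b 0 = 0 := by
        rw [hb]; simp [OpenPartialHomeomorph.univBall_apply_zero]
      rw [OpenPartialHomeomorph.trans_apply, h4, hef, Function.comp_apply, hκ0, hΦ0 _ hxD]
    rwa [h3] at h2
  · intro y hy
    have h1 := (heU (e.map_target (htgt y hy).1)).2
    rw [mem_preimage, ← hef, e.right_inv (htgt y hy).1] at h1
    exact hOU h1
  · rw [OpenPartialHomeomorph.coe_trans, hef]
    exact hΨs.comp hbsm.contDiffOn fun z hz => (hzs z hz).1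
  · rw [OpenPartialHomeomorph.coe_trans_symm]
    exact hbsym.comp (hes.mono fun y hy => (htgt y hy).1) fun y hy => (htgt y hy).2
  · intro z hz
    have h1 := hzs z hz
    have h2 : HasFDerivAt Φ (fderiv ℝ Φ (κ (b z))) (κ (b z)) :=
      ((hΦ.contDiffAt (hD.mem_nhds h1.1)).differentiableAt (by simp)).hasFDerivAt
    have h3 : HasFDerivAt b (fderiv ℝ b z) z := (hbsm.differentiable (by simp) z).hasFDerivAt
    have h4 : fderiv ℝ b z (1, 0) = (1, 0) := by
      have h5 : HasFDerivAt b ((ContinuousLinearMap.fst ℝ ℝ F).prod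
          ((fderiv ℝ (OpenPartialHomeomorph.univBall (0 : F) ε) z.2).comp
            (ContinuousLinearMap.snd ℝ ℝ F))) z := by
        refine hasFDerivAt_fst.prodMk (HasFDerivAt.comp z ?_ hasFDerivAt_snd)
        exact ((OpenPartialHomeomorph.contDiff_univBall (n := 1)).differentiable
          (by simp) z.2).hasFDerivAt
      rw [h5.fderiv]
      simp
    have h6 := h2.comp z ((hdκ (b z)).comp z h3)
    have h7 : ((b.trans e : OpenPartialHomeomorph (ℝ × F) E) : ℝ × F → E) = Φ ∘ κ ∘ b := by
      rw [OpenPartialHomeomorph.coe_trans, hef]; rfl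
    rw [h7]
    rw [show fderiv ℝ (Φ ∘ κ ∘ b) z = _ from h6.fderiv]
    simp only [ContinuousLinearMap.comp_apply, h4, ContinuousLinearMap.prod_apply]
    have h8 := hΦ' _ h1.1
    simp only [ContinuousLinearMap.coe_fst', zero_apply,
      ContinuousLinearMap.coe_snd', ContinuousLinearEquiv.coe_coe]
    have h9 : A ((0 : ℝ), (0 : F)) = 0 := map_zero A
    rw [h9, h8]
    exact hWV h1.2

end FlowBox

set_option linter.unusedSectionVars false

/-! ### The Levi-Civita connection in the preferred charts. -/

section CovDeriv

variable {E : Type*} [NormedAddCommGroup E] [NormedSpace ℝ E]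
  {H : Type*} [TopologicalSpace H] {I : ModelWithCorners ℝ E H}
  {M : Type*} [TopologicalSpace M] [ChartedSpace H M]
  {E' : Type*} [NormedAddCommGroup E'] [NormedSpace ℝ E']
  {H' : Type*} [TopologicalSpace H'] {J : ModelWithCorners ℝ E' H'}
  {N : Type*} [TopologicalSpace N] [ChartedSpace H' N]

/-- The derivative of a map between manifolds, as a map between the model spaces. -/
def modelDeriv (I : ModelWithCorners ℝ E H) (J : ModelWithCorners ℝ E' H') (f : M → N) (p : M) :
    E →L[ℝ] E' := mfderiv I J f p

/-- The metric at a point, as a bilinear form on the model space. -/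
def metricAt (g : MetricField J N) (x : N) : E' →L[ℝ] E' →L[ℝ] ℝ := g x

/-- The covariant derivative along a map, with values in the model space. -/
def covD (I : ModelWithCorners ℝ E H) (g : MetricField J N) (f : M → N)
    (V : ∀ p : M, TangentSpace J (f p)) (p : M) (w : E) : E' := covDerivAlong I g f V p w

/-- The coordinate expression of a vector field along `f` in the preferred chart around `x`. -/
def coordField (J : ModelWithCorners ℝ E' H') (f : M → N) (V : ∀ p : M, TangentSpace J (f p))
    (x : N) (q : M) : E' :=
  mfderiv J 𝓘(ℝ, E') (extChartAt J x) (f q) (V q)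

variable [IsManifold J 1 N]

/-- The tangent space at `x` is the model space read in the preferred chart at `x`, so that chart
has identity derivative there. Hence the chart derivatives disappear from `covD_eq`. -/
theorem mfderiv_extChartAt_self_apply (x : N) (v : TangentSpace J x) :
    (mfderiv J 𝓘(ℝ, E') (extChartAt J x) x v : E') = (v : E') := by
  rw [mfderiv_extChartAt_self]; rfl

theorem coordField_self (f : M → N) (V : ∀ p : M, TangentSpace J (f p)) (p : M) :
    coordField J f V (f p) p = (V p : E') := mfderiv_extChartAt_self_apply _ _

theorem covD_eq (g : MetricField J N) (f : M → N) (V : ∀ p : M, TangentSpace J (f p))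
    (p : M) (w : E) :
    covD I g f V p w = modelDeriv I 𝓘(ℝ, E') (coordField J f V (f p)) p w +
        christoffel g (f p) (modelDeriv I J f p w) (V p) := by
  have h1 : (mfderiv J 𝓘(ℝ, E') (extChartAt J (f p)) (f p)).inverse =
      ContinuousLinearMap.id ℝ E' := by
    rw [mfderiv_extChartAt_self]; exact ContinuousLinearMap.inverse_id
  have h2 := mfderiv_extChartAt_self_apply (f p) (V p)
  have h3 := mfderiv_extChartAt_self_apply (f p) (mfderiv I J f p w)
  unfold covD covDerivAlong
  simp only
  rw [h1]
  change modelDeriv I 𝓘(ℝ, E') (coordField J f V (f p)) p w +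
    christoffel g (f p) (mfderiv J 𝓘(ℝ, E') (extChartAt J (f p)) (f p) (mfderiv I J f p w) : E')
    (mfderiv J 𝓘(ℝ, E') (extChartAt J (f p)) (f p) (V p) : E') = _
  rw [h2, h3]
  rfl

variable [J.Boundaryless]

theorem mfderiv_extChartAt_symm_apply {x y : N} (hy : y ∈ (extChartAt J x).source)
    (v : TangentSpace J y) :
    (mfderiv 𝓘(ℝ, E') J (extChartAt J x).symm (extChartAt J x y)
      (mfderiv J 𝓘(ℝ, E') (extChartAt J x) y v : E') : E') = (v : E') := by
  have h := mfderivWithin_extChartAt_symm_comp_mfderiv_extChartAt' hy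
  rw [J.range_eq_univ, mfderivWithin_univ] at h
  exact DFunLike.congr_fun h v

theorem metric_eq_chartMetric (g : MetricField J N) {x y : N} (hy : y ∈ (extChartAt J x).source)
    (v w : TangentSpace J y) :
    g y v w = chartMetric g x (extChartAt J x y) (mfderiv J 𝓘(ℝ, E') (extChartAt J x) y v : E')
      (mfderiv J 𝓘(ℝ, E') (extChartAt J x) y w : E') := by
  have h1 := mfderiv_extChartAt_symm_apply hy v
  have h2 := mfderiv_extChartAt_symm_apply hy w
  have h3 : (extChartAt J x).symm (extChartAt J x y) = y := (extChartAt J x).left_inv hy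
  let γ : N → E' →L[ℝ] E' →L[ℝ] ℝ := g
  change γ y v w = γ ((extChartAt J x).symm (extChartAt J x y)) _ _
  rw [h3]
  exact (congrArg₂ (fun a b => γ y a b) h1 h2).symm

theorem chartMetric_self (g : MetricField J N) (x : N) (v w : E') :
    chartMetric g x (extChartAt J x x) v w = metricAt g x v w := by
  have h : metricAt g x v w = _ := metric_eq_chartMetric g (mem_extChartAt_source (I := J) x) v w
  rw [h]
  exact (congrArg₂ (fun a b => chartMetric g x (extChartAt J x x) a b)
    (mfderiv_extChartAt_self_apply x v) (mfderiv_extChartAt_self_apply x w)).symm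

theorem chartMetric_symm {g : MetricField J N} (hs : ∀ x v w, g x v w = g x w v) (x : N) (y v w : E') :
    chartMetric g x y v w = chartMetric g x y w v :=
  hs ((extChartAt J x).symm y) (modelDeriv 𝓘(ℝ, E') J (extChartAt J x).symm y v)
    (modelDeriv 𝓘(ℝ, E') J (extChartAt J x).symm y w)

/-- A metric field whose coordinate expressions are differentiable, symmetric and positive. -/
structure IsMetric (g : MetricField J N) : Prop where
  symm : ∀ x v w, g x v w = g x w v
  pos : ∀ x v, v ≠ 0 → 0 < g x v v
  diff : ∀ x, DifferentiableAt ℝ (chartMetric g x) (extChartAt J x x)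

theorem fderiv_chartMetric_symm {g : MetricField J N} (hg : IsMetric g) (x : N) (u v w : E') :
    fderiv ℝ (chartMetric g x) (extChartAt J x x) u v w =
      fderiv ℝ (chartMetric g x) (extChartAt J x x) u w v := by
  have h : ∀ v w : E', HasFDerivAt (fun y => chartMetric g x y v w)
      (((fderiv ℝ (chartMetric g x) (extChartAt J x x)).flip v).flip w) (extChartAt J x x) := by
    intro v w
    have h1 := (hg.diff x).hasFDerivAt.clm_apply (hasFDerivAt_const v _)
    have h2 := h1.clm_apply (hasFDerivAt_const w _)
    refine h2.congr_fderiv ?_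
    ext u
    simp
  have h3 : (fun y => chartMetric g x y v w) = fun y => chartMetric g x y w v :=
    funext fun y => chartMetric_symm hg.symm x y v w
  exact DFunLike.congr_fun ((h3 ▸ h v w).unique (h w v)) u

theorem christoffel_symm {g : MetricField J N} (hg : IsMetric g) (x : N) (u v : E') :
    christoffel g x u v = christoffel g x v u := by
  unfold christoffel
  simp only
  congr 2
  ext w
  have := fderiv_chartMetric_symm hg x w u v
  simp only [sub_apply, add_apply, ContinuousLinearMap.flip_apply]
  rw [this]
  ring

theorem metric_christoffel [FiniteDimensional ℝ E'] {g : MetricField J N} (hg : IsMetric g) (x : N)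
    (u v w : E') :
    metricAt g x (christoffel g x u v) w = (1 / 2) *
      (fderiv ℝ (chartMetric g x) (extChartAt J x x) u v w +
        fderiv ℝ (chartMetric g x) (extChartAt J x x) v u w -
        fderiv ℝ (chartMetric g x) (extChartAt J x x) w u v) := by
  rw [← chartMetric_christoffel g hg.pos]
  exact (chartMetric_self g x _ _).symm

/-- This is ∇g = 0 in coordinates: in the sum of the two Koszul formulas all terms cancel but the
derivative in the direction `u`. -/
theorem fderiv_chartMetric [FiniteDimensional ℝ E'] {g : MetricField J N} (hg : IsMetric g) (x : N)
    (u v w : E') :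
    fderiv ℝ (chartMetric g x) (extChartAt J x x) u v w =
      metricAt g x (christoffel g x u v) w + metricAt g x v (christoffel g x u w) := by
  have hs : metricAt g x v (christoffel g x u w) = metricAt g x (christoffel g x u w) v :=
    hg.symm x _ _
  rw [hs, metric_christoffel hg, metric_christoffel hg,
    fderiv_chartMetric_symm hg x w u v, fderiv_chartMetric_symm hg x v u w,
    fderiv_chartMetric_symm hg x u w v]
  ring

theorem hasMFDerivAt_prodMk_space {F₁ F₂ : Type*} [NormedAddCommGroup F₁] [NormedSpace ℝ F₁]
    [NormedAddCommGroup F₂] [NormedSpace ℝ F₂] {a : M → F₁} {b : M → F₂} {p : M}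
    {A : E →L[ℝ] F₁} {B : E →L[ℝ] F₂}
    (ha : HasMFDerivAt I 𝓘(ℝ, F₁) a p A) (hb : HasMFDerivAt I 𝓘(ℝ, F₂) b p B) :
    HasMFDerivAt I 𝓘(ℝ, F₁ × F₂) (fun q => (a q, b q)) p (A.prod B) := by
  have h1 : HasFDerivWithinAt (a ∘ (extChartAt I p).symm) A (range I) (extChartAt I p p) := ha.2
  have h2 : HasFDerivWithinAt (b ∘ (extChartAt I p).symm) B (range I) (extChartAt I p p) := hb.2
  exact ⟨ha.1.prodMk hb.1, h1.prodMk h2⟩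

theorem hasFDerivAt_comp_fst {X Z : Type*} [NormedAddCommGroup X] [NormedSpace ℝ X]
    [NormedAddCommGroup Z] [NormedSpace ℝ Z] {G : E' → X} {y : E'} (z : Z)
    (hG : DifferentiableAt ℝ G y) :
    HasFDerivAt (fun z : E' × Z => G z.1) ((fderiv ℝ G y).comp (ContinuousLinearMap.fst ℝ E' Z))
      (y, z) :=
  HasFDerivAt.comp (y, z) (show HasFDerivAt G (fderiv ℝ G y) ((y, z) : E' × Z).1 from
    hG.hasFDerivAt) hasFDerivAt_fst

set_option synthInstance.maxHeartbeats 100000 in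
theorem hasFDerivAt_bilin_apply {G : E' → E' →L[ℝ] E' →L[ℝ] ℝ} {y : E'} (v w : E')
    (hG : DifferentiableAt ℝ G y) :
    HasFDerivAt (fun z : E' × E' × E' => G z.1 z.2.1 z.2.2)
      (ContinuousLinearMap.coprod (((fderiv ℝ G y).flip v).flip w)
        (ContinuousLinearMap.coprod ((G y).flip w) (G y v))) (y, v, w) := by
  have h1 : HasFDerivAt (fun z : E' × E' × E' => G z.1)
      ((fderiv ℝ G y).comp (ContinuousLinearMap.fst ℝ E' (E' × E'))) (y, v, w) :=
    hasFDerivAt_comp_fst (X := E' →L[ℝ] E' →L[ℝ] ℝ) (G := G) (y := y) ((v, w) : E' × E') hG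
  have h2 : HasFDerivAt (fun z : E' × E' × E' => z.2.1)
      ((ContinuousLinearMap.fst ℝ E' E').comp (ContinuousLinearMap.snd ℝ E' (E' × E'))) (y, v, w) :=
    ((ContinuousLinearMap.fst ℝ E' E').comp (ContinuousLinearMap.snd ℝ E' (E' × E'))).hasFDerivAt
  have h3 : HasFDerivAt (fun z : E' × E' × E' => z.2.2)
      ((ContinuousLinearMap.snd ℝ E' E').comp (ContinuousLinearMap.snd ℝ E' (E' × E'))) (y, v, w) :=
    ((ContinuousLinearMap.snd ℝ E' E').comp (ContinuousLinearMap.snd ℝ E' (E' × E'))).hasFDerivAt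
  refine ((h1.clm_apply h2).clm_apply h3).congr_fderiv ?_
  ext u <;> simp

/-- The Levi-Civita connection is compatible with the metric. -/
theorem hasMFDerivAt_metric [FiniteDimensional ℝ E'] {g : MetricField J N} (hg : IsMetric g)
    {f : M → N} {V W : ∀ p : M, TangentSpace J (f p)} {p : M} (hf : MDifferentiableAt I J f p)
    (hV : MDifferentiableAt I 𝓘(ℝ, E') (coordField J f V (f p)) p)
    (hW : MDifferentiableAt I 𝓘(ℝ, E') (coordField J f W (f p)) p) :
    MDifferentiableAt I 𝓘(ℝ, ℝ) (fun q => g (f q) (V q) (W q)) p ∧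
      ∀ w : E, modelDeriv I 𝓘(ℝ, ℝ) (fun q => g (f q) (V q) (W q)) p w =
          metricAt g (f p) (covD I g f V p w) (W p) +
          metricAt g (f p) (V p) (covD I g f W p w) := by
  set φ := extChartAt J (f p) with hφ
  let G := chartMetric g (f p)
  let V' := coordField J f V (f p)
  let W' := coordField J f W (f p)
  let B : E' × E' × E' → ℝ := fun z => G z.1 z.2.1 z.2.2
  have hφf : HasMFDerivAt I 𝓘(ℝ, E') (fun q => φ (f q)) p ((mfderiv J 𝓘(ℝ, E') φ (f p)).comp
      (mfderiv I J f p)) :=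
    (mdifferentiableAt_extChartAt (mem_chart_source H' (f p))).hasMFDerivAt.comp p hf.hasMFDerivAt
  let k : M → E' × E' × E' := fun q => (φ (f q), V' q, W' q)
  have hk : HasMFDerivAt I 𝓘(ℝ, E' × E' × E') k p
      ((modelDeriv J 𝓘(ℝ, E') φ (f p) ∘L modelDeriv I J f p).prod
        ((modelDeriv I 𝓘(ℝ, E') V' p).prod (modelDeriv I 𝓘(ℝ, E') W' p))) :=
    hasMFDerivAt_prodMk_space hφf (hasMFDerivAt_prodMk_space hV.hasMFDerivAt hW.hasMFDerivAt)
  have hB : HasFDerivAt B _ (k p) := hasFDerivAt_bilin_apply (V' p) (W' p) (hg.diff (f p))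
  have h := HasMFDerivAt.comp p hB.hasMFDerivAt hk
  have hev : (fun q => g (f q) (V q) (W q)) =ᶠ[𝓝 p] B ∘ k := by
    have h1 : ∀ᶠ q in 𝓝 p, f q ∈ φ.source :=
      hf.continuousAt.preimage_mem_nhds (extChartAt_source_mem_nhds (f p))
    filter_upwards [h1] with q hq
    exact metric_eq_chartMetric g hq (V q) (W q)
  have h' := h.congr_of_eventuallyEq hev
  refine ⟨h'.mdifferentiableAt, fun w => ?_⟩
  have e1 : modelDeriv J 𝓘(ℝ, E') φ (f p) (modelDeriv I J f p w) = modelDeriv I J f p w :=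
    mfderiv_extChartAt_self_apply _ _
  have eV : V' p = V p := coordField_self f V p
  have eW : W' p = W p := coordField_self f W p
  have key : modelDeriv I 𝓘(ℝ, ℝ) (fun q => g (f q) (V q) (W q)) p w =
      fderiv ℝ G (φ (f p)) (modelDeriv J 𝓘(ℝ, E') φ (f p) (modelDeriv I J f p w)) (V' p) (W' p) +
      (G (φ (f p)) (modelDeriv I 𝓘(ℝ, E') V' p w) (W' p) +
        G (φ (f p)) (V' p) (modelDeriv I 𝓘(ℝ, E') W' p w)) := by
    unfold modelDeriv
    rw [h'.mfderiv]
    rfl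
  -- The Christoffel terms from the derivative of the metric complete the derivatives of the two
  -- coordinate fields to covariant derivatives.
  rw [key, e1, fderiv_chartMetric hg (f p), chartMetric_self, chartMetric_self, covD_eq, covD_eq,
    eV, eW]
  obtain ⟨v, hv⟩ : ∃ v : E', v = V p := ⟨_, rfl⟩
  obtain ⟨u, hu⟩ : ∃ u : E', u = W p := ⟨_, rfl⟩
  simp only [← hv, ← hu, map_add, add_apply]
  ring

/-- The chain rule for covariant derivatives along maps. -/
theorem covD_comp {E₀ : Type*} [NormedAddCommGroup E₀] [NormedSpace ℝ E₀]
    {H₀ : Type*} [TopologicalSpace H₀] {I₀ : ModelWithCorners ℝ E₀ H₀}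
    {P : Type*} [TopologicalSpace P] [ChartedSpace H₀ P] (g : MetricField J N)
    {f : M → N} {V : ∀ p : M, TangentSpace J (f p)} {k : P → M} {z : P}
    (hk : MDifferentiableAt I₀ I k z) (hf : MDifferentiableAt I J f (k z))
    (hV : MDifferentiableAt I 𝓘(ℝ, E') (coordField J f V (f (k z))) (k z))
    (w : E₀) :
    covD I₀ g (f ∘ k) (fun z => V (k z)) z w = covD I g f V (k z) (modelDeriv I₀ I k z w) := by
  have h1 : modelDeriv I₀ 𝓘(ℝ, E') (coordField J (f ∘ k) (fun z => V (k z)) ((f ∘ k) z)) z =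
      (modelDeriv I 𝓘(ℝ, E') (coordField J f V (f (k z))) (k z)).comp (modelDeriv I₀ I k z) :=
    mfderiv_comp z hV hk
  have h2 : modelDeriv I₀ J (f ∘ k) z = (modelDeriv I J f (k z)).comp (modelDeriv I₀ I k z) :=
    mfderiv_comp z hf hk
  rw [covD_eq, covD_eq, h1, h2]
  rfl

end CovDeriv

/-! ### Smoothness of fields and metrics along maps; absence of torsion. -/

section Smoothness

variable {E : Type*} [NormedAddCommGroup E] [NormedSpace ℝ E]
  {H : Type*} [TopologicalSpace H] {I : ModelWithCorners ℝ E H}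
  {M : Type*} [TopologicalSpace M] [ChartedSpace H M]
  {E' : Type*} [NormedAddCommGroup E'] [NormedSpace ℝ E']
  {H' : Type*} [TopologicalSpace H'] {J : ModelWithCorners ℝ E' H'}
  {N : Type*} [TopologicalSpace N] [ChartedSpace H' N] [IsManifold J ∞ N]
  {E₀ : Type*} [NormedAddCommGroup E₀] [NormedSpace ℝ E₀]

/-- Near `p` the coordinate field is the fibre component of the section in the tangent bundle
trivialization at `x`. -/
theorem contMDiffAt_coordField {f : M → N} {V : ∀ p : M, TangentSpace J (f p)} {p : M} {x : N}
    (hx : f p ∈ (chartAt H' x).source)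
    (hV : ContMDiffAt I J.tangent ∞ (fun q => (⟨f q, V q⟩ : TangentBundle J N)) p) :
    ContMDiffAt I 𝓘(ℝ, E') ∞ (coordField J f V x) p := by
  let e := trivializationAt E' (TangentSpace J : N → Type _) x
  have hf : ContMDiffAt I J ∞ f p := (contMDiffAt_totalSpace.1 hV).1
  have hsrc : (⟨f p, V p⟩ : TangentBundle J N) ∈ e.source := by
    rw [e.mem_source]; exact hx
  have h1 : ContMDiffAt (J.prod 𝓘(ℝ, E')) (J.prod 𝓘(ℝ, E')) ∞ e (⟨f p, V p⟩ : TangentBundle J N) :=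
    (e.contMDiffOn (IB := J) (n := ∞)).contMDiffAt (e.open_source.mem_nhds hsrc)
  have h2 := contMDiffAt_snd.comp p (h1.comp p hV)
  refine h2.congr_of_eventuallyEq ?_
  filter_upwards [hf.continuousAt.preimage_mem_nhds ((chartAt H' x).open_source.mem_nhds hx)]
    with q hq
  have h3 := TangentBundle.continuousLinearMapAt_trivializationAt (I := J) (x₀ := x) (x := f q) hq
  unfold coordField
  rw [← h3]
  exact e.continuousLinearMapAt_apply_of_mem ℝ hq (V q)

theorem contMDiffOn_mfderiv_const {h : E₀ → N} {U : Set E₀} (hU : IsOpen U)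
    (hh : ContMDiffOn 𝓘(ℝ, E₀) J ∞ h U) (u : E₀) :
    ContMDiffOn 𝓘(ℝ, E₀) J.tangent ∞
      (fun z => (⟨h z, mfderiv 𝓘(ℝ, E₀) J h z u⟩ : TangentBundle J N)) U := by
  have h1 := hh.contMDiffOn_tangentMapWithin (m := ∞) (by simp) hU.uniqueMDiffOn
  have h2 : ContMDiffOn 𝓘(ℝ, E₀) 𝓘(ℝ, E₀).tangent ∞
      (fun z => (⟨z, u⟩ : TangentBundle 𝓘(ℝ, E₀) E₀)) U :=
    contMDiffOn_vectorSpace_iff_contDiffOn.2 contDiffOn_const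
  refine (h1.comp h2 fun z hz => hz).congr fun z hz => ?_
  have h3 : mfderivWithin 𝓘(ℝ, E₀) J h U z = mfderiv 𝓘(ℝ, E₀) J h z :=
    mfderivWithin_of_isOpen hU hz
  simp only [Function.comp_apply, tangentMapWithin, h3]

theorem contMDiffOn_metric (g : ContMDiffRiemannianMetric J ∞ E' (fun x : N => TangentSpace J x))
    {f : M → N} {V W : ∀ p : M, TangentSpace J (f p)} {U : Set M}
    (hV : ContMDiffOn I J.tangent ∞ (fun q => (⟨f q, V q⟩ : TangentBundle J N)) U)
    (hW : ContMDiffOn I J.tangent ∞ (fun q => (⟨f q, W q⟩ : TangentBundle J N)) U) :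
    ContMDiffOn I 𝓘(ℝ, ℝ) ∞ (fun q => g.inner (f q) (V q) (W q)) U := by
  intro p hp
  have hf : ContMDiffWithinAt I J ∞ f U p := (contMDiffWithinAt_totalSpace.1 (hV p hp)).1
  have h : ContMDiffWithinAt I (J.prod 𝓘(ℝ)) ∞
      (fun q => TotalSpace.mk' ℝ (E := Bundle.Trivial N ℝ) (f q) (g.inner (f q) (V q) (W q)))
      U p := by
    apply ContMDiffWithinAt.clm_bundle_apply₂ (F₁ := E') (F₂ := E')
    · exact ContMDiffAt.comp_contMDiffWithinAt p g.contMDiff.contMDiffAt hf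
    · exact hV p hp
    · exact hW p hp
  exact (contMDiffWithinAt_totalSpace.1 h).2

theorem contDiffOn_pullbackMetric [FiniteDimensional ℝ E₀]
    (g : ContMDiffRiemannianMetric J ∞ E' (fun x : N => TangentSpace J x))
    {h : E₀ → N} {U : Set E₀} (hU : IsOpen U) (hh : ContMDiffOn 𝓘(ℝ, E₀) J ∞ h U) :
    ContDiffOn ℝ ∞ (metricAt (pullbackMetric 𝓘(ℝ, E₀) g.inner h)) U := by
  rw [contDiffOn_clm_apply]
  intro u
  rw [contDiffOn_clm_apply]
  intro v
  exact (contMDiffOn_metric g (contMDiffOn_mfderiv_const hU hh u)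
    (contMDiffOn_mfderiv_const hU hh v)).contDiffOn

variable [J.Boundaryless]

theorem contDiffOn_chartMetric [FiniteDimensional ℝ E']
    (g : ContMDiffRiemannianMetric J ∞ E' (fun x : N => TangentSpace J x)) (x : N) :
    ContDiffOn ℝ ∞ (chartMetric g.inner x) (extChartAt J x).target :=
  contDiffOn_pullbackMetric g (isOpen_extChartAt_target x) (contMDiffOn_extChartAt_symm x)

theorem isMetric_inner [FiniteDimensional ℝ E']
    (g : ContMDiffRiemannianMetric J ∞ E' (fun x : N => TangentSpace J x)) :
    IsMetric g.inner where
  symm := g.symm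
  pos := g.pos
  diff x := ((contDiffOn_chartMetric g x).contDiffAt
    ((isOpen_extChartAt_target x).mem_nhds (mem_extChartAt_target x))).differentiableAt (by simp)

section Pullback

variable [FiniteDimensional ℝ E] [IsManifold I ∞ M] [I.Boundaryless]

theorem contMDiffOn_comp_extChartAt_symm {f : M → N} (hf : ContMDiff I J ∞ f) (x : M) :
    ContMDiffOn 𝓘(ℝ, E) J ∞ (f ∘ (extChartAt I x).symm) (extChartAt I x).target :=
  hf.comp_contMDiffOn (contMDiffOn_extChartAt_symm x)

/-- By the chain rule, questions about the induced metric in a chart become questions about a map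
from a vector space into `N`. -/
theorem chartMetric_pullbackMetric (g : MetricField J N) {f : M → N} (hf : ContMDiff I J ∞ f)
    (x : M) {y : E} (hy : y ∈ (extChartAt I x).target) :
    chartMetric (pullbackMetric I g f) x y =
      metricAt (pullbackMetric 𝓘(ℝ, E) g (f ∘ (extChartAt I x).symm)) y := by
  have h1 : MDifferentiableAt 𝓘(ℝ, E) I (extChartAt I x).symm y :=
    ((contMDiffOn_extChartAt_symm (n := ∞) x).contMDiffAt
      ((isOpen_extChartAt_target x).mem_nhds hy)).mdifferentiableAt (by simp)
  have h2 : mfderiv 𝓘(ℝ, E) J (f ∘ (extChartAt I x).symm) y = _ :=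
    mfderiv_comp y ((hf _).mdifferentiableAt (by simp)) h1
  ext u v
  change g (f ((extChartAt I x).symm y)) _ _ = g (f ((extChartAt I x).symm y))
    (mfderiv 𝓘(ℝ, E) J (f ∘ (extChartAt I x).symm) y u)
    (mfderiv 𝓘(ℝ, E) J (f ∘ (extChartAt I x).symm) y v)
  rw [h2]
  rfl

theorem isMetric_pullbackMetric
    (g : ContMDiffRiemannianMetric J ∞ E' (fun x : N => TangentSpace J x))
    {f : M → N} (hf : IsSmoothImmersion I J f) :
    IsMetric (pullbackMetric I g.inner f) where
  symm x v w := g.symm _ _ _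
  pos x v hv := g.pos _ _ fun h0 => hv (hf.2 x (h0.trans (map_zero _).symm))
  diff x := by
    have h1 := (contDiffOn_pullbackMetric g (isOpen_extChartAt_target x)
      (contMDiffOn_comp_extChartAt_symm hf.1 x)).contDiffAt
      ((isOpen_extChartAt_target x).mem_nhds (mem_extChartAt_target x))
    refine (h1.differentiableAt (by simp)).congr_of_eventuallyEq ?_
    filter_upwards [(isOpen_extChartAt_target x).mem_nhds (mem_extChartAt_target x)] with y hy
    exact chartMetric_pullbackMetric g.inner hf.1 x hy

end Pullback

section SecondDerivative

theorem contDiffAt_extChartAt_comp {h : E₀ → N} {z : E₀} {x : N}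
    (hh : ContMDiffAt 𝓘(ℝ, E₀) J ∞ h z) (hx : h z ∈ (chartAt H' x).source) :
    ContDiffAt ℝ ∞ (extChartAt J x ∘ h) z :=
  ((contMDiffAt_extChartAt' hx).comp z hh).contDiffAt

theorem coordField_mfderiv_apply {h : E₀ → N} {z : E₀} {x : N}
    (hh : MDifferentiableAt 𝓘(ℝ, E₀) J h z) (hx : h z ∈ (chartAt H' x).source) (u : E₀) :
    (mfderiv J 𝓘(ℝ, E') (extChartAt J x) (h z) (mfderiv 𝓘(ℝ, E₀) J h z u) : E') =
      fderiv ℝ (extChartAt J x ∘ h) z u := by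
  have h1 : mfderiv 𝓘(ℝ, E₀) 𝓘(ℝ, E') (extChartAt J x ∘ h) z = _ :=
    mfderiv_comp z (mdifferentiableAt_extChartAt hx) hh
  rw [mfderiv_eq_fderiv] at h1
  exact (DFunLike.congr_fun h1 u).symm

theorem modelDeriv_eq_fderiv {h : E₀ → N} {z : E₀} (hh : MDifferentiableAt 𝓘(ℝ, E₀) J h z) :
    modelDeriv 𝓘(ℝ, E₀) J h z = fderiv ℝ (extChartAt J (h z) ∘ h) z := by
  ext u
  rw [← coordField_mfderiv_apply hh (mem_chart_source H' (h z))]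
  exact (mfderiv_extChartAt_self_apply (h z) _).symm

/-- The derivative of a smooth map in a constant direction has smooth coordinates. -/
theorem coordField_mfderiv_eventuallyEq {h : E₀ → N} {z : E₀}
    (hh : ∀ᶠ z' in 𝓝 z, MDifferentiableAt 𝓘(ℝ, E₀) J h z') (u : E₀) :
    coordField J h (fun z => mfderiv 𝓘(ℝ, E₀) J h z u) (h z) =ᶠ[𝓝 z]
      fun z' => fderiv ℝ (extChartAt J (h z) ∘ h) z' u := by
  have hc : ContinuousAt h z := hh.self_of_nhds.continuousAt
  filter_upwards [hh, hc.preimage_mem_nhds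
    ((chartAt H' (h z)).open_source.mem_nhds (mem_chart_source H' (h z)))] with z' h1 h2
  exact coordField_mfderiv_apply h1 h2 u

theorem eventually_mdifferentiableAt {h : M → N} {z : M} [IsManifold I ∞ M]
    (hh : ContMDiffAt I J ∞ h z) : ∀ᶠ z' in 𝓝 z, MDifferentiableAt I J h z' := by
  have h1 : ContMDiffAt I J 1 h z := hh.of_le (by simp)
  exact ((contMDiffAt_iff_contMDiffAt_nhds (by simp)).1 h1).mono fun z' h => h.mdifferentiableAt (by simp)

theorem hasFDerivAt_fderiv_apply {F : E₀ → E'} {z : E₀} (hF : ContDiffAt ℝ ∞ F z) (u : E₀) :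
    HasFDerivAt (fun z' => fderiv ℝ F z' u) ((fderiv ℝ (fderiv ℝ F) z).flip u) z := by
  have h1 : DifferentiableAt ℝ (fderiv ℝ F) z :=
    (hF.fderiv_right (m := 1) (by norm_cast)).differentiableAt (by simp)
  refine (h1.hasFDerivAt.clm_apply (hasFDerivAt_const u z)).congr_fderiv ?_
  ext w
  simp

theorem mdifferentiableAt_coordField_mfderiv {h : E₀ → N} {z : E₀}
    (hh : ContMDiffAt 𝓘(ℝ, E₀) J ∞ h z) (u : E₀) :
    MDifferentiableAt 𝓘(ℝ, E₀) 𝓘(ℝ, E')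
      (coordField J h (fun z => mfderiv 𝓘(ℝ, E₀) J h z u) (h z)) z := by
  rw [mdifferentiableAt_iff_differentiableAt]
  exact ((hasFDerivAt_fderiv_apply (contDiffAt_extChartAt_comp hh (mem_chart_source H' (h z)))
    u).differentiableAt).congr_of_eventuallyEq
    (coordField_mfderiv_eventuallyEq (eventually_mdifferentiableAt hh) u)

/-- For coordinate fields the covariant derivative is a second derivative plus a Christoffel term,
both symmetric in `u` and `w`; torsion-freeness follows. -/
theorem covD_mfderiv (g : MetricField J N) {h : E₀ → N} {z : E₀}
    (hh : ContMDiffAt 𝓘(ℝ, E₀) J ∞ h z) (u w : E₀) :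
    covD 𝓘(ℝ, E₀) g h (fun z => mfderiv 𝓘(ℝ, E₀) J h z u) z w =
      fderiv ℝ (fderiv ℝ (extChartAt J (h z) ∘ h)) z w u +
        christoffel g (h z) (modelDeriv 𝓘(ℝ, E₀) J h z w) (modelDeriv 𝓘(ℝ, E₀) J h z u) := by
  have h1 : modelDeriv 𝓘(ℝ, E₀) 𝓘(ℝ, E')
      (coordField J h (fun z => mfderiv 𝓘(ℝ, E₀) J h z u) (h z)) z =
      (fderiv ℝ (fderiv ℝ (extChartAt J (h z) ∘ h)) z).flip u := by
    have h2 := (hasFDerivAt_fderiv_apply (contDiffAt_extChartAt_comp hh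
      (mem_chart_source H' (h z))) u).congr_of_eventuallyEq
      (coordField_mfderiv_eventuallyEq (eventually_mdifferentiableAt hh) u)
    exact mfderiv_eq_fderiv.trans h2.fderiv
  rw [covD_eq, h1]
  rfl

/-- The Levi-Civita connection is torsion free. -/
theorem covD_mfderiv_symm {g : MetricField J N} (hg : IsMetric g) {h : E₀ → N} {z : E₀}
    (hh : ContMDiffAt 𝓘(ℝ, E₀) J ∞ h z) (u w : E₀) :
    covD 𝓘(ℝ, E₀) g h (fun z => mfderiv 𝓘(ℝ, E₀) J h z u) z w =
      covD 𝓘(ℝ, E₀) g h (fun z => mfderiv 𝓘(ℝ, E₀) J h z w) z u := by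
  rw [covD_mfderiv g hh, covD_mfderiv g hh, christoffel_symm hg]
  have h1 := (contDiffAt_extChartAt_comp hh (mem_chart_source H' (h z))).isSymmSndFDerivAt
    (by simpa using ENat.LEInfty.out)
  rw [h1.eq]

end SecondDerivative

end Smoothness

/-! ### The Gauss formula for curves in a submanifold. -/

section Gauss

variable {E : Type*} [NormedAddCommGroup E] [NormedSpace ℝ E]
  {H : Type*} [TopologicalSpace H] {I : ModelWithCorners ℝ E H} [I.Boundaryless]
  {M : Type*} [TopologicalSpace M] [ChartedSpace H M] [IsManifold I ∞ M]
  {E' : Type*} [NormedAddCommGroup E'] [NormedSpace ℝ E']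
  {H' : Type*} [TopologicalSpace H'] {J : ModelWithCorners ℝ E' H'} [J.Boundaryless]
  {N : Type*} [TopologicalSpace N] [ChartedSpace H' N] [IsManifold J ∞ N]

theorem fderiv_fderiv_comp {E₀ : Type*} [NormedAddCommGroup E₀] [NormedSpace ℝ E₀]
    {F : E → E'} {c : E₀ → E} {t : E₀} (hc : ContDiffAt ℝ ∞ c t) (hF : ContDiffAt ℝ ∞ F (c t))
    (u w : E₀) :
    fderiv ℝ (fderiv ℝ (F ∘ c)) t w u =
      fderiv ℝ (fderiv ℝ F) (c t) (fderiv ℝ c t w) (fderiv ℝ c t u) +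
        fderiv ℝ F (c t) (fderiv ℝ (fderiv ℝ c) t w u) := by
  have h1 := (hasFDerivAt_fderiv_apply (hF.comp t hc) u).fderiv
  have hev : (fun s => fderiv ℝ (F ∘ c) s u) =ᶠ[𝓝 t] fun s => fderiv ℝ F (c s) (fderiv ℝ c s u) := by
    have hc1 : ∀ᶠ s in 𝓝 t, ContDiffAt ℝ 1 c s := (hc.of_le (by simp)).eventually (by simp)
    have hF1 : ∀ᶠ s in 𝓝 t, ContDiffAt ℝ 1 F (c s) :=
      hc.continuousAt.eventually ((hF.of_le (by simp)).eventually (by simp))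
    filter_upwards [hc1, hF1] with s hs hs'
    rw [fderiv_comp s (hs'.differentiableAt (by simp)) (hs.differentiableAt (by simp))]
    rfl
  have h2 : HasFDerivAt (fun s => fderiv ℝ F (c s))
      ((fderiv ℝ (fderiv ℝ F) (c t)).comp (fderiv ℝ c t)) t :=
    HasFDerivAt.comp (g := fderiv ℝ F) t
      ((hF.fderiv_right (m := 1) (by norm_cast)).differentiableAt (by simp)).hasFDerivAt
      (hc.differentiableAt (by simp)).hasFDerivAt
  have h3 := ((h2.clm_apply (hasFDerivAt_fderiv_apply hc u)).congr_of_eventuallyEq hev).fderiv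
  have h4 := DFunLike.congr_fun (h1.symm.trans h3) w
  simp only [ContinuousLinearMap.flip_apply, add_apply, ContinuousLinearMap.comp_apply] at h4
  rw [h4, add_comm]

theorem modelDeriv_comp_extChartAt_symm {f : M → N} {x : M} (hf : MDifferentiableAt I J f x) :
    modelDeriv 𝓘(ℝ, E) J (f ∘ (extChartAt I x).symm) (extChartAt I x x) = modelDeriv I J f x := by
  have h0 : (extChartAt I x).symm (extChartAt I x x) = x := extChartAt_to_inv x
  have h1 : MDifferentiableAt 𝓘(ℝ, E) I (extChartAt I x).symm (extChartAt I x x) :=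
    ((contMDiffOn_extChartAt_symm (n := ∞) x).contMDiffAt
      ((isOpen_extChartAt_target x).mem_nhds (mem_extChartAt_target x))).mdifferentiableAt (by simp)
  have h2 : modelDeriv 𝓘(ℝ, E) J (f ∘ (extChartAt I x).symm) (extChartAt I x x) =
      (modelDeriv I J f ((extChartAt I x).symm (extChartAt I x x))).comp
        (modelDeriv 𝓘(ℝ, E) I (extChartAt I x).symm (extChartAt I x x)) :=
    mfderiv_comp _ (h0.symm ▸ hf) h1
  have h3 : modelDeriv 𝓘(ℝ, E) I (extChartAt I x).symm (extChartAt I x x) =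
      ContinuousLinearMap.id ℝ E := by
    ext v
    have h4 := mfderiv_extChartAt_symm_apply (mem_extChartAt_source (I := I) x) v
    have h5 := mfderiv_extChartAt_self_apply (J := I) x v
    rw [h5] at h4
    exact h4
  rw [h2, h0, h3, ContinuousLinearMap.comp_id]

/-- Metric compatibility applied to the fields `dh(v)` and `dh(w)` along `h`. -/
theorem fderiv_pullbackMetric [FiniteDimensional ℝ E] [FiniteDimensional ℝ E']
    (g : ContMDiffRiemannianMetric J ∞ E' (fun x : N => TangentSpace J x)) {h : E → N} {U : Set E}
    (hU : IsOpen U) (hh : ContMDiffOn 𝓘(ℝ, E) J ∞ h U) {y : E} (hy : y ∈ U) (u v w : E) :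
    fderiv ℝ (metricAt (pullbackMetric 𝓘(ℝ, E) g.inner h)) y u v w =
      metricAt g.inner (h y) (covD 𝓘(ℝ, E) g.inner h (fun z => mfderiv 𝓘(ℝ, E) J h z v) y u)
        (modelDeriv 𝓘(ℝ, E) J h y w) +
      metricAt g.inner (h y) (modelDeriv 𝓘(ℝ, E) J h y v)
        (covD 𝓘(ℝ, E) g.inner h (fun z => mfderiv 𝓘(ℝ, E) J h z w) y u) := by
  have hh' := hh.contMDiffAt (hU.mem_nhds hy)
  have hP := ((contDiffOn_pullbackMetric g hU hh).contDiffAt (hU.mem_nhds hy)).differentiableAt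
    (by simp)
  have h1 := hP.hasFDerivAt.clm_apply (hasFDerivAt_const v _)
  have h2 : HasFDerivAt (fun y => metricAt (pullbackMetric 𝓘(ℝ, E) g.inner h) y v w)
      (((fderiv ℝ (metricAt (pullbackMetric 𝓘(ℝ, E) g.inner h)) y).flip v).flip w) y := by
    refine (h1.clm_apply (hasFDerivAt_const w _)).congr_fderiv ?_
    ext u
    simp only [ContinuousLinearMap.comp_zero, zero_add]
  have h4 := (hasMFDerivAt_metric (isMetric_inner g) (hh'.mdifferentiableAt (by simp))
    (mdifferentiableAt_coordField_mfderiv hh' v) (mdifferentiableAt_coordField_mfderiv hh' w)).2 u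
  have h5 : modelDeriv 𝓘(ℝ, E) 𝓘(ℝ, ℝ) (fun q => g.inner (h q) (mfderiv 𝓘(ℝ, E) J h q v)
    (mfderiv 𝓘(ℝ, E) J h q w)) y u = _ :=
    DFunLike.congr_fun (mfderiv_eq_fderiv.trans h2.fderiv) u
  exact h5.symm.trans h4

/-- The Koszul formula for the induced metric. -/
theorem metric_christoffel_pullbackMetric [FiniteDimensional ℝ E] [FiniteDimensional ℝ E']
    (g : ContMDiffRiemannianMetric J ∞ E' (fun x : N => TangentSpace J x)) {f : M → N}
    (hf : IsSmoothImmersion I J f) (x : M) (a w : E) :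
    metricAt (pullbackMetric I g.inner f) x (christoffel (pullbackMetric I g.inner f) x a a) w =
      metricAt g.inner (f x) (fderiv ℝ (fderiv ℝ (extChartAt J (f x) ∘ f ∘ (extChartAt I x).symm))
        (extChartAt I x x) a a +
        christoffel g.inner (f x) (modelDeriv I J f x a) (modelDeriv I J f x a))
        (modelDeriv I J f x w) := by
  set y := extChartAt I x x with hy
  set h := f ∘ (extChartAt I x).symm with hh
  have hyt : (extChartAt I x).target ∈ 𝓝 y :=
    (isOpen_extChartAt_target x).mem_nhds (mem_extChartAt_target x)
  have hh' : ContMDiffAt 𝓘(ℝ, E) J ∞ h y :=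
    (contMDiffOn_comp_extChartAt_symm hf.1 x).contMDiffAt hyt
  have hg := isMetric_inner g
  have hgm := isMetric_pullbackMetric g hf
  have h0 : h y = f x := congrArg f (extChartAt_to_inv x)
  have hD : modelDeriv 𝓘(ℝ, E) J h y = modelDeriv I J f x :=
    modelDeriv_comp_extChartAt_symm ((hf.1 x).mdifferentiableAt (by simp))
  let D : E → E → E' := fun u v => covD 𝓘(ℝ, E) g.inner h (fun z => mfderiv 𝓘(ℝ, E) J h z v) y u
  have hDs : ∀ u v, D u v = D v u := fun u v => covD_mfderiv_symm hg hh' v u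
  have key : ∀ u v w, fderiv ℝ (chartMetric (pullbackMetric I g.inner f) x) y u v w =
      metricAt g.inner (f x) (D u v) (modelDeriv I J f x w) +
      metricAt g.inner (f x) (modelDeriv I J f x v) (D u w) := by
    intro u v w
    have hev : chartMetric (pullbackMetric I g.inner f) x =ᶠ[𝓝 y]
        metricAt (pullbackMetric 𝓘(ℝ, E) g.inner h) := by
      filter_upwards [hyt] with q hq
      exact chartMetric_pullbackMetric g.inner hf.1 x hq
    have hd := fderiv_pullbackMetric (h := h) (y := y) g (isOpen_extChartAt_target x)
      (contMDiffOn_comp_extChartAt_symm hf.1 x) (mem_extChartAt_target x) u v w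
    rw [h0, hD] at hd
    rw [hev.fderiv_eq]
    exact hd
  -- By the symmetry of `D`, the terms pairing `df(a)` with `D a w` cancel in the Koszul formula and
  -- only `D a a` remains.
  rw [metric_christoffel hgm, ← hy, key, key, hDs w a]
  have hs : ∀ a b, metricAt g.inner (f x) a b = metricAt g.inner (f x) b a := g.symm (f x)
  have hDa : D a a = fderiv ℝ (fderiv ℝ (extChartAt J (f x) ∘ h)) y a a +
      christoffel g.inner (f x) (modelDeriv I J f x a) (modelDeriv I J f x a) := by
    have := covD_mfderiv g.inner hh' a a
    rw [h0, hD] at this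
    exact this
  rw [← hDa, hs (modelDeriv I J f x a) (D a w)]
  ring

/-- The tangential part of the acceleration of a curve in a submanifold is its acceleration with
respect to the induced metric. -/
theorem metric_covD_velocity_comp [FiniteDimensional ℝ E] [FiniteDimensional ℝ E']
    (g : ContMDiffRiemannianMetric J ∞ E' (fun x : N => TangentSpace J x)) {f : M → N}
    (hf : IsSmoothImmersion I J f) {γ : ℝ → M} {t : ℝ} (hγ : ContMDiffAt 𝓘(ℝ, ℝ) I ∞ γ t) (w : E) :
    metricAt g.inner (f (γ t)) (covD 𝓘(ℝ, ℝ) g.inner (f ∘ γ) (velocity J (f ∘ γ)) t 1)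
        (modelDeriv I J f (γ t) w) =
      metricAt (pullbackMetric I g.inner f) (γ t)
        (covD 𝓘(ℝ, ℝ) (pullbackMetric I g.inner f) γ (velocity I γ) t 1) w := by
  set x := γ t with hx
  set h := f ∘ (extChartAt I x).symm with hh
  set y := extChartAt I x x with hy
  have hfγ : ContMDiffAt 𝓘(ℝ, ℝ) J ∞ (f ∘ γ) t := (hf.1 _).comp t hγ
  have hyt : (extChartAt I x).target ∈ 𝓝 y :=
    (isOpen_extChartAt_target x).mem_nhds (mem_extChartAt_target x)
  have hh' : ContMDiffAt 𝓘(ℝ, E) J ∞ h y :=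
    (contMDiffOn_comp_extChartAt_symm hf.1 x).contMDiffAt hyt
  have h0 : h y = f x := congrArg f (extChartAt_to_inv x)
  let c : ℝ → E := extChartAt I x ∘ γ
  let F : E → E' := extChartAt J (f x) ∘ h
  have hc : ContDiffAt ℝ ∞ c t := contDiffAt_extChartAt_comp hγ (mem_chart_source H (γ t))
  have hF : ContDiffAt ℝ ∞ F y :=
    contDiffAt_extChartAt_comp hh' (h0 ▸ mem_chart_source H' (f x))
  have hFd : fderiv ℝ F y = modelDeriv I J f x := by
    rw [← modelDeriv_comp_extChartAt_symm ((hf.1 x).mdifferentiableAt (by simp)),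
      modelDeriv_eq_fderiv (hh'.mdifferentiableAt (by simp)), h0]
  set a : E := modelDeriv 𝓘(ℝ, ℝ) I γ t 1 with ha
  have hca : fderiv ℝ c t 1 = a := by
    rw [ha, modelDeriv_eq_fderiv (hγ.mdifferentiableAt (by simp))]
  have hfa : modelDeriv 𝓘(ℝ, ℝ) J (f ∘ γ) t 1 = modelDeriv I J f x a := by
    have : modelDeriv 𝓘(ℝ, ℝ) J (f ∘ γ) t = (modelDeriv I J f (γ t)).comp
        (modelDeriv 𝓘(ℝ, ℝ) I γ t) :=
      mfderiv_comp t ((hf.1 _).mdifferentiableAt (by simp)) (hγ.mdifferentiableAt (by simp))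
    rw [this]; rfl
  have hev : extChartAt J (f x) ∘ f ∘ γ =ᶠ[𝓝 t] F ∘ c := by
    filter_upwards [hγ.continuousAt.preimage_mem_nhds (extChartAt_source_mem_nhds (I := I) (γ t))]
      with s hs
    simp only [F, c, h, Function.comp_apply]
    rw [(extChartAt I x).left_inv hs]
  have hM : covD 𝓘(ℝ, ℝ) (pullbackMetric I g.inner f) γ (velocity I γ) t 1 =
      fderiv ℝ (fderiv ℝ c) t 1 1 + christoffel (pullbackMetric I g.inner f) x a a :=
    covD_mfderiv (pullbackMetric I g.inner f) hγ 1 1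
  have hN : covD 𝓘(ℝ, ℝ) g.inner (f ∘ γ) (velocity J (f ∘ γ)) t 1 =
      fderiv ℝ (fderiv ℝ (F ∘ c)) t 1 1 +
        christoffel g.inner (f x) (modelDeriv I J f x a) (modelDeriv I J f x a) := by
    have h1 := covD_mfderiv g.inner hfγ 1 1
    rw [hfa] at h1
    refine h1.trans ?_
    have h2 : fderiv ℝ (fderiv ℝ (extChartAt J ((f ∘ γ) t) ∘ f ∘ γ)) t =
      fderiv ℝ (fderiv ℝ (F ∘ c)) t := hev.fderiv.fderiv_eq
    rw [h2]
    rfl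
  have hcomp := fderiv_fderiv_comp hc hF 1 1
  have hct : c t = y := rfl
  rw [hct, hca, hFd] at hcomp
  -- The ambient acceleration is F''(a, a) + F'(c'') + Γ(df a, df a). The middle term pairs to the
  -- induced metric of c'', and the other two give the induced Christoffel term.
  rw [hM, hN, hcomp, map_add (metricAt (pullbackMetric I g.inner f) x), add_apply,
    metric_christoffel_pullbackMetric g hf x a w]
  have hp : ∀ u v, metricAt (pullbackMetric I g.inner f) x u v =
    metricAt g.inner (f x) (modelDeriv I J f x u) (modelDeriv I J f x v) := fun u v => rfl
  rw [hp]
  simp only [map_add, add_apply]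
  ring

end Gauss

/-- The map `(w, a) ↦ D w + a • y` is injective because `y` is outside the range of `D`, and its
source and target have equal dimension. -/
theorem exists_eq_add_smul {E E' : Type*} [NormedAddCommGroup E] [NormedSpace ℝ E]
    [NormedAddCommGroup E'] [NormedSpace ℝ E'] [FiniteDimensional ℝ E] [FiniteDimensional ℝ E']
    (hEE : Module.finrank ℝ E' = Module.finrank ℝ E + 1) {D : E →L[ℝ] E'}
    (hD : Function.Injective D) {y : E'} (hy : ¬ ∃ w, D w = y) (v : E') :
    ∃ (w : E) (a : ℝ), v = D w + a • y := by
  let A : E × ℝ →ₗ[ℝ] E' := D.toLinearMap.coprod (LinearMap.toSpanSingleton ℝ E' y)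
  have hA : ∀ z, A z = D z.1 + z.2 • y := fun z => by simp [A]
  have hinj : Function.Injective A := by
    rw [injective_iff_map_eq_zero]
    rintro ⟨w, a⟩ h
    rw [hA] at h
    have ha : a = 0 := by
      by_contra ha
      refine hy ⟨-(a⁻¹ • w), ?_⟩
      have h1 : D w = -(a • y) := eq_neg_of_add_eq_zero_left h
      rw [map_neg, map_smul, h1, smul_neg, neg_neg, smul_smul, inv_mul_cancel₀ ha, one_smul]
    have hw : D w = D 0 := by simpa [ha] using h
    rw [ha, hD hw]
    rfl
  have hsurj := (LinearMap.injective_iff_surjective_of_finrank_eq_finrank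
    (by rw [Module.finrank_prod, Module.finrank_self, hEE])).1 hinj
  obtain ⟨⟨w, a⟩, h⟩ := hsurj v
  exact ⟨w, a, by rw [← h, hA]⟩

/-- Cauchy-Schwarz with its equality case: a maximiser `w` gives B(T - cw, T - cw) = B(T, T) - c² ≥
0, and the competitor T/|T| gives |T| ≤ c. Replacing `w` by `-w` shows c ≥ 0. -/
theorem eq_sq_of_isGreatest {E : Type*} [NormedAddCommGroup E] [NormedSpace ℝ E]
    {B : E →L[ℝ] E →L[ℝ] ℝ} (hs : ∀ v w, B v w = B w v) (hB : ∀ v, v ≠ 0 → 0 < B v v) {T : E}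
    {c : ℝ} (hc : IsGreatest {r : ℝ | ∃ w, B w w = 1 ∧ r = B w T} c) : B T T = c ^ 2 := by
  obtain ⟨⟨w, hw, hwc⟩, hub⟩ := hc
  have hn : -c ≤ c := hub ⟨-w, by simp [hw], by simp [hwc]⟩
  have h0 : 0 ≤ B (T - c • w) (T - c • w) := by
    rcases eq_or_ne (T - c • w) 0 with h | h
    · rw [h]; simp
    · exact (hB _ h).le
  simp only [map_sub, sub_apply, map_smul, smul_apply, smul_eq_mul, hs T w, ← hwc, hw] at h0
  refine le_antisymm ?_ (by nlinarith)
  rcases eq_or_ne T 0 with rfl | hT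
  · simp [sq_nonneg]
  · have hTT := hB T hT
    set a := √(B T T) with ha
    have ha0 : 0 < a := Real.sqrt_pos.2 hTT
    have haa : a * a = B T T := Real.mul_self_sqrt hTT.le
    have h1 : a ≤ c := hub ⟨a⁻¹ • T, by
      simp only [map_smul, smul_apply, smul_eq_mul, ← haa]; field_simp, by
      simp only [map_smul, smul_apply, smul_eq_mul, ← haa]; field_simp⟩
    nlinarith

/-! ### Constancy of |Y| and |tan(Y)|, and the statements about geodesics. -/

section Helix

variable {E : Type*} [NormedAddCommGroup E] [NormedSpace ℝ E] [FiniteDimensional ℝ E]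
  {H : Type*} [TopologicalSpace H] {I : ModelWithCorners ℝ E H} [I.Boundaryless]
  {M : Type*} [TopologicalSpace M] [ChartedSpace H M] [IsManifold I ∞ M]
  {E' : Type*} [NormedAddCommGroup E'] [NormedSpace ℝ E'] [FiniteDimensional ℝ E']
  {H' : Type*} [TopologicalSpace H'] {J : ModelWithCorners ℝ E' H'} [J.Boundaryless]
  {N : Type*} [TopologicalSpace N] [ChartedSpace H' N] [IsManifold J ∞ N]

/-- On a ball in a chart the function is constant, so it is locally constant on the connected `M`.
-/
theorem eq_of_modelDeriv_eq_zero [ConnectedSpace M] {h : M → ℝ}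
    (hh : ∀ p, MDifferentiableAt I 𝓘(ℝ, ℝ) h p) (h0 : ∀ p, modelDeriv I 𝓘(ℝ, ℝ) h p = 0) (p q : M) :
    h p = h q := by
  suffices hl : IsLocallyConstant h from hl.apply_eq_of_preconnectedSpace p q
  rw [IsLocallyConstant.iff_eventually_eq]
  intro x
  let φ := extChartAt I x
  obtain ⟨r, hr, hball⟩ := Metric.isOpen_iff.1 (isOpen_extChartAt_target (I := I) x) (φ x)
    (mem_extChartAt_target x)
  have hd : ∀ y ∈ Metric.ball (φ x) r, HasFDerivAt (h ∘ φ.symm) (0 : E →L[ℝ] ℝ) y := by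
    intro y hy
    have h1 : MDifferentiableAt 𝓘(ℝ, E) I φ.symm y :=
      ((contMDiffOn_extChartAt_symm (n := ∞) x).contMDiffAt
        ((isOpen_extChartAt_target x).mem_nhds (hball hy))).mdifferentiableAt (by simp)
    have h2 := (HasMFDerivAt.comp y (hh (φ.symm y)).hasMFDerivAt h1.hasMFDerivAt).hasFDerivAt
    have h3 : (modelDeriv I 𝓘(ℝ, ℝ) h (φ.symm y)).comp (modelDeriv 𝓘(ℝ, E) I φ.symm y) = 0 := by
      rw [h0]; rfl
    exact h2.congr_fderiv h3
  have hev : ∀ᶠ z in 𝓝 x, z ∈ φ.source ∧ φ z ∈ Metric.ball (φ x) r :=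
    Filter.Eventually.and (extChartAt_source_mem_nhds (I := I) x)
      ((continuousAt_extChartAt x).preimage_mem_nhds (Metric.ball_mem_nhds _ hr))
  filter_upwards [hev] with z hz
  have h4 := Metric.isOpen_ball.is_const_of_fderiv_eq_zero
    (convex_ball (φ x) r).isPreconnected (fun y hy => (hd y hy).differentiableAt.differentiableWithinAt)
    (fun y hy => (hd y hy).fderiv) hz.2 (Metric.mem_ball_self hr)
  simpa only [Function.comp_apply, φ.left_inv hz.1, φ.left_inv (mem_extChartAt_source x)] using h4

variable {g : ContMDiffRiemannianMetric J ∞ E' (fun x : N => TangentSpace J x)}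
  {f : M → N} {Y : ∀ p : M, TangentSpace J (f p)}

theorem IsSmoothAlong.mdifferentiableAt_coordField (hY : IsSmoothAlong I J f Y) (p : M) :
    MDifferentiableAt I 𝓘(ℝ, E') (coordField J f Y (f p)) p :=
  (contMDiffAt_coordField (mem_chart_source H' (f p)) (hY p)).mdifferentiableAt (by simp)

theorem IsParallelAlong.metric_self_eq [ConnectedSpace M] (hf : ContMDiff I J ∞ f)
    (hY : IsParallelAlong I g.inner f Y) (p q : M) :
    metricAt g.inner (f p) (Y p) (Y p) = metricAt g.inner (f q) (Y q) (Y q) := by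
  have hd := fun p => hasMFDerivAt_metric (isMetric_inner g) ((hf p).mdifferentiableAt (by simp))
    (hY.1.mdifferentiableAt_coordField p) (hY.1.mdifferentiableAt_coordField p)
  refine eq_of_modelDeriv_eq_zero (I := I) (fun p => (hd p).1) (fun p => ?_) p q
  ext w
  have h0 : covD I g.inner f Y p w = 0 := hY.2 p w
  rw [(hd p).2 w, h0, map_zero, map_zero, add_zero]
  rfl

/-- A geodesic of a hypersurface along which a parallel transversal field makes a constant angle is
a geodesic of the ambient manifold. -/
theorem IsGeodesicOn.comp_of_isParallelAlong (hEE : Module.finrank ℝ E' = Module.finrank ℝ E + 1)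
    (hf : IsSmoothImmersion I J f) (hY : IsParallelAlong I g.inner f Y) {γ : ℝ → M} {s : Set ℝ}
    (hs : IsOpen s) (hγ : IsGeodesicOn (pullbackMetric I g.inner f) γ s)
    (hn : ∀ p, ¬ IsTangentAt I f p (Y p)) {c : ℝ}
    (hc : ∀ t ∈ s, metricAt g.inner (f (γ t)) (modelDeriv I J f (γ t) (modelDeriv 𝓘(ℝ, ℝ) I γ t 1))
      (Y (γ t)) = c) : IsGeodesicOn g.inner (f ∘ γ) s := by
  refine ⟨hf.1.comp_contMDiffOn hγ.1, fun t ht => ?_⟩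
  have hγs : ∀ t ∈ s, ContMDiffAt 𝓘(ℝ, ℝ) I ∞ γ t := fun t ht =>
    hγ.1.contMDiffAt (hs.mem_nhds ht)
  have hγt := hγs t ht
  have hfγ : ContMDiffAt 𝓘(ℝ, ℝ) J ∞ (f ∘ γ) t := (hf.1 _).comp t hγt
  set A : E' := covD 𝓘(ℝ, ℝ) g.inner (f ∘ γ) (velocity J (f ∘ γ)) t 1 with hA
  suffices h : A = 0 from h
  -- The tangential part of the acceleration is the intrinsic acceleration, which is zero.
  have h1 : ∀ w : E, metricAt g.inner (f (γ t)) A (modelDeriv I J f (γ t) w) = 0 := by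
    intro w
    rw [hA, metric_covD_velocity_comp g hf hγt]
    have h0 : covD 𝓘(ℝ, ℝ) (pullbackMetric I g.inner f) γ (velocity I γ) t 1 = 0 := hγ.2 t ht
    rw [h0]
    simp
  have hcoY := hY.1.mdifferentiableAt_coordField (γ t)
  have hcov : covD 𝓘(ℝ, ℝ) g.inner (f ∘ γ) (fun t => Y (γ t)) t 1 = 0 := by
    rw [covD_comp g.inner (hγt.mdifferentiableAt (by simp)) ((hf.1 _).mdifferentiableAt (by simp))
      hcoY]
    exact hY.2 _ _
  have hcoY' : MDifferentiableAt 𝓘(ℝ, ℝ) 𝓘(ℝ, E')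
      (coordField J (f ∘ γ) (fun t => Y (γ t)) ((f ∘ γ) t)) t :=
    hcoY.comp t (hγt.mdifferentiableAt (by simp))
  -- Differentiating the constant g(γ', Y) leaves only g(∇γ', Y), because Y is parallel.
  have h2 : metricAt g.inner (f (γ t)) A (Y (γ t)) = 0 := by
    have h3 := (hasMFDerivAt_metric (V := velocity J (f ∘ γ)) (isMetric_inner g)
      (hfγ.mdifferentiableAt (by simp)) (mdifferentiableAt_coordField_mfderiv hfγ 1) hcoY').2 1
    rw [hcov, map_zero, add_zero] at h3
    refine h3.symm.trans ?_
    have hev : (fun t => g.inner ((f ∘ γ) t) (velocity J (f ∘ γ) t) (Y (γ t))) =ᶠ[𝓝 t]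
        fun _ => c := by
      filter_upwards [hs.mem_nhds ht] with t ht
      have h4 : modelDeriv 𝓘(ℝ, ℝ) J (f ∘ γ) t = (modelDeriv I J f (γ t)).comp
          (modelDeriv 𝓘(ℝ, ℝ) I γ t) :=
        mfderiv_comp t ((hf.1 _).mdifferentiableAt (by simp))
          ((hγs t ht).mdifferentiableAt (by simp))
      rw [← hc t ht]
      exact congrArg (fun L : ℝ →L[ℝ] E' => metricAt g.inner (f (γ t)) (L 1) (Y (γ t))) h4
    have h5 : modelDeriv 𝓘(ℝ, ℝ) 𝓘(ℝ, ℝ)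
        (fun t => g.inner ((f ∘ γ) t) (velocity J (f ∘ γ) t) (Y (γ t))) t = 0 := by
      have h6 := hev.fderiv_eq (𝕜 := ℝ)
      rw [fderiv_const_apply] at h6
      exact mfderiv_eq_fderiv.trans h6
    rw [h5]
    rfl
  by_contra hA0
  obtain ⟨w, a, hwa⟩ := exists_eq_add_smul hEE (hf.2 (γ t)) (hn (γ t)) A
  have hpos : 0 < metricAt g.inner (f (γ t)) A A := (isMetric_inner g).pos _ _ hA0
  have h7 : metricAt g.inner (f (γ t)) A A =
      metricAt g.inner (f (γ t)) A (modelDeriv I J f (γ t) w) +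
        a * metricAt g.inner (f (γ t)) A (Y (γ t)) := by
    have h8 : ∀ y z : E', metricAt g.inner (f (γ t)) A (y + a • z) =
      metricAt g.inner (f (γ t)) A y + a * metricAt g.inner (f (γ t)) A z := fun y z => by simp
    exact (congrArg (metricAt g.inner (f (γ t)) A) hwa).trans (h8 _ _)
  rw [h1, h2] at h7
  simp [h7] at hpos

/-- The tangential part, with values in the model space. -/
def tanPart (I : ModelWithCorners ℝ E H) (g : MetricField J N) (f : M → N)
    (Y : ∀ p : M, TangentSpace J (f p)) (p : M) : E := tangentialPart I g f Y p

theorem metric_tanPart (hf : IsSmoothImmersion I J f) (p : M) (w : E) :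
    metricAt (pullbackMetric I g.inner f) p w (tanPart I g.inner f Y p) =
      metricAt g.inner (f p) (modelDeriv I J f p w) (Y p) := by
  have h := tangentialPart_spec g.inner g.pos f hf Y p w
  rw [g.symm] at h
  have h1 : ∀ y z x : E', metricAt g.inner (f p) x (y - z) =
    metricAt g.inner (f p) x y - metricAt g.inner (f p) x z := fun y z x => by simp
  have h2 := (h1 (Y p) (modelDeriv I J f p (tanPart I g.inner f Y p)) (modelDeriv I J f p w)).symm.trans h
  exact (sub_eq_zero.1 h2).symm

theorem isTangentAt_iff (hf : IsSmoothImmersion I J f) (p : M) :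
    IsTangentAt I f p (Y p) ↔ modelDeriv I J f p (tanPart I g.inner f Y p) = Y p := by
  refine ⟨fun ⟨w, hw⟩ => ?_, fun h => ⟨_, h⟩⟩
  have hM := isMetric_pullbackMetric g hf
  obtain ⟨T, hT⟩ : ∃ T : E, T = tanPart I g.inner f Y p := ⟨_, rfl⟩
  obtain ⟨v, hv⟩ : ∃ v : E, v = w := ⟨_, rfl⟩
  replace hw : modelDeriv I J f p v = Y p := by rw [hv]; exact hw
  have h1 : ∀ u : E, metricAt (pullbackMetric I g.inner f) p u (v - T) = 0 := by
    intro u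
    have h2 := metric_tanPart (g := g) (Y := Y) hf p u
    have h3 : metricAt (pullbackMetric I g.inner f) p u v =
      metricAt g.inner (f p) (modelDeriv I J f p u) (Y p) :=
      congrArg (metricAt g.inner (f p) (modelDeriv I J f p u)) hw
    rw [map_sub, h3, hT, h2, sub_self]
  have h4 : v - T = 0 := by
    by_contra h0
    exact (hM.pos p _ h0).ne' (h1 _)
  exact hT ▸ sub_eq_zero.1 h4 ▸ hw

/-- Because |Y - T|² = |Y|² - |T|², tangency is an equality between two quantities that are constant
on a helix hypersurface, hence independent of the point. -/
theorem isTangentAt_iff_metric (hf : IsSmoothImmersion I J f) (p : M) :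
    IsTangentAt I f p (Y p) ↔ metricAt g.inner (f p) (Y p) (Y p) =
      metricAt (pullbackMetric I g.inner f) p (tanPart I g.inner f Y p)
        (tanPart I g.inner f Y p) := by
  rw [isTangentAt_iff (g := g) hf]
  obtain ⟨T, hT⟩ : ∃ T : E, T = tanPart I g.inner f Y p := ⟨_, rfl⟩
  obtain ⟨y, hy⟩ : ∃ y : E', y = Y p := ⟨_, rfl⟩
  have h1 : metricAt (pullbackMetric I g.inner f) p T T =
      metricAt g.inner (f p) (modelDeriv I J f p T) y := by
    rw [hT, metric_tanPart hf, hy]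
  have hp : ∀ u v : E, metricAt (pullbackMetric I g.inner f) p u v =
    metricAt g.inner (f p) (modelDeriv I J f p u) (modelDeriv I J f p v) := fun u v => rfl
  have hs : ∀ u v : E', metricAt g.inner (f p) u v = metricAt g.inner (f p) v u := g.symm (f p)
  rw [← hT, ← hy]
  constructor
  · intro h
    rw [h1, h]
  · intro h
    by_contra h0
    have h2 : modelDeriv I J f p T - y ≠ 0 := sub_ne_zero.2 h0
    have h3 : 0 < metricAt g.inner (f p) (modelDeriv I J f p T - y) (modelDeriv I J f p T - y) :=
      (isMetric_inner g).pos _ _ h2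
    simp only [map_sub, sub_apply, ← hp, ← h1, h, hs y] at h3
    simp at h3

theorem IsHelix.exists_metric_tanPart (hf : IsSmoothImmersion I J f) (hM : IsHelix I g.inner f Y) :
    ∃ c : ℝ, ∀ p, metricAt (pullbackMetric I g.inner f) p (tanPart I g.inner f Y p)
        (tanPart I g.inner f Y p) = c := by
  obtain ⟨-, c, hc⟩ := hM
  refine ⟨c ^ 2, fun p => ?_⟩
  have hP := isMetric_pullbackMetric g hf
  refine eq_sq_of_isGreatest (E := E) (hP.symm p) (hP.pos p) ?_
  convert hc p using 1
  ext r
  refine exists_congr fun w => and_congr Iff.rfl ?_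
  have h := metric_tanPart (g := g) (Y := Y) hf p w
  exact ⟨fun h' => h'.trans h, fun h' => h'.trans h.symm⟩

/-- Orthogonality at one point forces T = 0 everywhere. So Y is normal and of constant nonzero
length, hence nowhere tangent, and g(γ', Y) = 0 on every curve of M. -/
theorem IsHelix.isTotallyGeodesic [ConnectedSpace M]
    (hEE : Module.finrank ℝ E' = Module.finrank ℝ E + 1) (hf : IsSmoothImmersion I J f)
    (hM : IsHelix I g.inner f Y) (hY : ∃ p, Y p ≠ 0) {p : M}
    (hp : IsOrthogonalAt I g.inner f p (Y p)) : IsTotallyGeodesic I g.inner f := by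
  obtain ⟨c, hc⟩ := hM.exists_metric_tanPart hf
  obtain ⟨q, hq⟩ := hY
  have hP := isMetric_pullbackMetric g hf
  have hc0 : c = 0 := by
    rw [← hc p, metric_tanPart hf]
    exact (g.symm _ _ _).trans (hp _)
  have hT : ∀ q, tanPart I g.inner f Y q = 0 := by
    intro q
    by_contra h0
    exact (hP.pos q _ h0).ne' ((hc q).trans hc0)
  intro γ s hs _ hγ
  refine hγ.comp_of_isParallelAlong hEE hf hM.1 hs (fun r hr => ?_) (c := 0) fun t _ => ?_
  · rw [isTangentAt_iff_metric (g := g) hf, hc, hc0, hM.1.metric_self_eq hf.1 r q] at hr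
    exact (g.pos _ _ hq).ne' hr
  · rw [← metric_tanPart hf, hT, map_zero]

/-- Non-tangency spreads from `p` to all of M, and on an integral curve of T the product g(γ', Y) =
|T|² is constant. -/
theorem IsHelix.isGeodesicOn_comp [ConnectedSpace M]
    (hEE : Module.finrank ℝ E' = Module.finrank ℝ E + 1) (hf : IsSmoothImmersion I J f)
    (hM : IsHelix I g.inner f Y) {p : M} (hp : ¬ IsTangentAt I f p (Y p)) {γ : ℝ → M} {s : Set ℝ}
    (hs : IsOpen s) (hγT : IsMIntegralCurveOn γ (tangentialPart I g.inner f Y) s)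
    (hγ : IsGeodesicOn (pullbackMetric I g.inner f) γ s) : IsGeodesicOn g.inner (f ∘ γ) s := by
  obtain ⟨c, hc⟩ := hM.exists_metric_tanPart hf
  refine hγ.comp_of_isParallelAlong hEE hf hM.1 hs (fun r hr => hp ?_) (c := c) fun t ht => ?_
  · rw [isTangentAt_iff_metric (g := g) hf, hc] at hr ⊢
    rw [← hr, hM.1.metric_self_eq hf.1]
  · have h1 : modelDeriv 𝓘(ℝ, ℝ) I γ t 1 = tanPart I g.inner f Y (γ t) := by
      have h2 := ((hγT t ht).hasMFDerivAt (hs.mem_nhds ht)).mfderiv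
      have h3 : modelDeriv 𝓘(ℝ, ℝ) I γ t =
        (1 : ℝ →L[ℝ] ℝ).smulRight (tanPart I g.inner f Y (γ t)) := h2
      rw [h3]
      simp
    rw [h1, ← metric_tanPart hf, hc]

end Helix

/-! ### Riemannian metrics on a vector space from smooth families of inner products. -/

section VectorSpaceMetric

variable {F : Type*} [NormedAddCommGroup F] [NormedSpace ℝ F] [FiniteDimensional ℝ F]

/-- The minimum of the quadratic form on the compact unit sphere is positive and bounds it below by
a multiple of the squared norm. -/
theorem isVonNBounded_of_pos {B : F →L[ℝ] F →L[ℝ] ℝ} (hB : ∀ v, v ≠ 0 → 0 < B v v) :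
    Bornology.IsVonNBounded ℝ {v : F | B v v < 1} := by
  rw [NormedSpace.isVonNBounded_iff]
  rcases (Metric.sphere (0 : F) 1).eq_empty_or_nonempty with h0 | h0
  · have hF : Subsingleton F := by
      by_contra hF
      rw [not_subsingleton_iff_nontrivial] at hF
      exact (NormedSpace.sphere_nonempty.2 zero_le_one).ne_empty h0
    exact (Set.subsingleton_of_subsingleton (s := {v : F | B v v < 1})).finite.isBounded
  · have hc : Continuous fun v : F => B v v := by fun_prop
    obtain ⟨u, hu, hmin⟩ := (isCompact_sphere (0 : F) 1).exists_isMinOn h0 hc.continuousOn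
    have hu1 : ‖u‖ = 1 := by simpa using hu
    have hpos := hB u (norm_pos_iff.1 (by simp [hu1]))
    refine (Metric.isBounded_closedBall (x := (0 : F)) (r := √(B u u)⁻¹)).subset fun v hv => ?_
    rw [mem_closedBall_zero_iff]
    refine Real.le_sqrt_of_sq_le ?_
    rcases eq_or_ne v 0 with rfl | hv0
    · simpa using hpos.le
    have hn : 0 < ‖v‖ := norm_pos_iff.2 hv0
    have h1 : B u u ≤ B (‖v‖⁻¹ • v) (‖v‖⁻¹ • v) :=
      hmin (by simp [norm_smul, hn.ne'])
    simp only [map_smul, smul_apply, smul_eq_mul] at h1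
    have h2 : B u u * ‖v‖ ^ 2 ≤ B v v := by
      calc B u u * ‖v‖ ^ 2 ≤ (‖v‖⁻¹ * (‖v‖⁻¹ * B v v)) * ‖v‖ ^ 2 := by gcongr
        _ = B v v := by field_simp
    have h3 : B v v < 1 := hv
    rw [le_inv_comm₀ (by positivity) hpos, ← one_div, le_div_iff₀ (by positivity)]
    linarith

/-- The trivializations of the tangent bundle of a vector space are identities, so the section read
in them is `metricAt G` itself. -/
theorem contMDiff_metricField (G : MetricField 𝓘(ℝ, F) F) (hG : ContDiff ℝ ∞ (metricAt G)) :
    ContMDiff 𝓘(ℝ, F) (𝓘(ℝ, F).prod 𝓘(ℝ, F →L[ℝ] F →L[ℝ] ℝ)) ∞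
      (fun x => TotalSpace.mk' (F →L[ℝ] F →L[ℝ] ℝ) x (G x)) := by
  intro x
  rw [contMDiffAt_section]
  have h : ContMDiffAt 𝓘(ℝ, F) 𝓘(ℝ, F →L[ℝ] F →L[ℝ] ℝ) ∞ (metricAt G) x := hG.contMDiff x
  refine h.congr_of_eventuallyEq (Filter.Eventually.of_forall fun y => ?_)
  change (((trivializationAt (F →L[ℝ] ℝ) (fun x : F => TangentSpace 𝓘(ℝ, F) x →L[ℝ] ℝ)
    x).continuousLinearMapAt ℝ y).comp ((G y).comp
      ((trivializationAt F (TangentSpace 𝓘(ℝ, F)) x).symmL ℝ y)) : F →L[ℝ] F →L[ℝ] ℝ) = metricAt G y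
  ext v w
  change ((trivializationAt (F →L[ℝ] ℝ) (fun x : F => TangentSpace 𝓘(ℝ, F) x →L[ℝ] ℝ)
    x).continuousLinearMapAt ℝ y) (G y
      ((trivializationAt F (TangentSpace 𝓘(ℝ, F)) x).symmL ℝ y v)) w = metricAt G y v w
  rw [Bundle.Trivialization.continuousLinearMapAt_apply,
    Bundle.Trivialization.linearMapAt_apply, if_pos]
  · change (ContinuousLinearMap.inCoordinates F (TangentSpace 𝓘(ℝ, F)) ℝ (Bundle.Trivial F ℝ) x y
      x y (G y ((trivializationAt F (TangentSpace 𝓘(ℝ, F)) x).symmL ℝ y v))) w = metricAt G y v w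
    change ((trivializationAt ℝ (Bundle.Trivial F ℝ) x).continuousLinearMapAt ℝ y)
      (G y ((trivializationAt F (TangentSpace 𝓘(ℝ, F)) x).symmL ℝ y v)
      ((trivializationAt F (TangentSpace 𝓘(ℝ, F)) x).symmL ℝ y w)) = metricAt G y v w
    simp only [TangentBundle.symmL_model_space]
    exact DFunLike.congr_fun (Bundle.Trivial.continuousLinearMapAt_trivialization ℝ F ℝ y) _
  · exact ⟨mem_chart_source F y, mem_univ y⟩

/-- A smooth family of inner products, as a Riemannian metric on a vector space. -/
def riemannianMetricOfContDiff (G : F → F →L[ℝ] F →L[ℝ] ℝ) (hG : ContDiff ℝ ∞ G)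
    (hs : ∀ x v w, G x v w = G x w v) (hp : ∀ x v, v ≠ 0 → 0 < G x v v) :
    ContMDiffRiemannianMetric 𝓘(ℝ, F) ∞ F (fun x : F => TangentSpace 𝓘(ℝ, F) x) where
  inner x := G x
  symm x := hs x
  pos x := hp x
  isVonNBounded x := isVonNBounded_of_pos (F := F) (hp x)
  contMDiff := contMDiff_metricField G hG

end VectorSpaceMetric

theorem contDiffOn_inverse_of_pos {X V : Type*} [NormedAddCommGroup X] [NormedSpace ℝ X]
    [NormedAddCommGroup V] [NormedSpace ℝ V] [FiniteDimensional ℝ V]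
    {G : X → V →L[ℝ] V →L[ℝ] ℝ} {U : Set X} (hG : ContDiffOn ℝ ∞ G U)
    (hp : ∀ x ∈ U, ∀ v, v ≠ 0 → 0 < G x v v) : ContDiffOn ℝ ∞ (fun x => (G x).inverse) U := by
  intro x hx
  have hinj : Function.Injective (G x) := by
    rw [injective_iff_map_eq_zero]
    intro v hv
    by_contra h
    simpa [hv] using hp x hx v h
  have hfr : Module.finrank ℝ V = Module.finrank ℝ (V →L[ℝ] ℝ) := by
    rw [← LinearEquiv.finrank_eq (LinearMap.toContinuousLinearMap (𝕜 := ℝ) (E := V) (F' := ℝ))]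
    exact (Subspace.dual_finrank_eq (K := ℝ) (V := V)).symm
  let e : V ≃L[ℝ] (V →L[ℝ] ℝ) :=
    (LinearEquiv.ofInjectiveOfFinrankEq (G x).toLinearMap hinj hfr).toContinuousLinearEquiv
  have he : G x = (e : V →L[ℝ] V →L[ℝ] ℝ) := by
    ext; rfl
  have := FiniteDimensional.complete ℝ V
  have h1 : ContDiffAt ℝ ∞ ContinuousLinearMap.inverse (G x) := he ▸ contDiffAt_map_inverse e
  exact h1.comp_contDiffWithinAt x (hG x hx)

/-! ### Splitting a metric on a box that is invariant along the first coordinate. -/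

section Decomposition

variable {F : Type*} [NormedAddCommGroup F] [NormedSpace ℝ F]
  {P : ℝ × F → ℝ × F →L[ℝ] ℝ × F →L[ℝ] ℝ} {ε κ : ℝ}

theorem apply_eq_apply_zero {X : Type*} [NormedAddCommGroup X] [NormedSpace ℝ X]
    {P : ℝ × F → X} (hP : ContDiffOn ℝ ∞ P (Ioo (-ε) ε ×ˢ univ))
    (h2 : ∀ z ∈ Ioo (-ε) ε ×ˢ univ, fderiv ℝ P z (1, 0) = 0) {z : ℝ × F}
    (hz : z ∈ Ioo (-ε) ε ×ˢ univ) : P z = P (0, z.2) := by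
  have hd : ∀ s ∈ Ioo (-ε) ε, HasDerivAt (fun s : ℝ => P (s, z.2)) 0 s := by
    intro s hs
    have hsz : (s, z.2) ∈ Ioo (-ε) ε ×ˢ (univ : Set F) := ⟨hs, mem_univ _⟩
    have h3 := ((hP.contDiffAt ((isOpen_Ioo.prod isOpen_univ).mem_nhds hsz)).differentiableAt
      (by simp)).hasFDerivAt
    have h4 : HasDerivAt (fun s : ℝ => (s, z.2)) (1, 0) s :=
      (hasDerivAt_id s).prodMk (hasDerivAt_const s z.2)
    have h5 := h3.comp_hasDerivAt s h4
    rw [h2 _ hsz] at h5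
    exact h5
  have hε : 0 < ε := by
    have := hz.1.1.trans hz.1.2
    linarith
  exact isOpen_Ioo.is_const_of_deriv_eq_zero isPreconnected_Ioo
    (fun s hs => (hd s hs).differentiableAt.differentiableWithinAt) (fun s hs => by simpa using (hd s hs).deriv)
    hz.1 (y := 0) ⟨by linarith, hε⟩

-- Hypothesis `h2` says that the metric is independent of s, and `h3` that the 1-form dual to ∂_s is
-- closed. Completing the square in the first coordinate gives the splitting.
set_option synthInstance.maxHeartbeats 200000 in
theorem exists_line_decomposition [FiniteDimensional ℝ F] (hε : 0 < ε) (hκ : 0 < κ)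
    (hP : ContDiffOn ℝ ∞ P (Ioo (-ε) ε ×ˢ univ))
    (hs : ∀ z ∈ Ioo (-ε) ε ×ˢ univ, ∀ u v, P z u v = P z v u)
    (hp : ∀ z ∈ Ioo (-ε) ε ×ˢ univ, ∀ u, u ≠ 0 → 0 < P z u u)
    (h1 : ∀ z ∈ Ioo (-ε) ε ×ˢ univ, P z (1, 0) (1, 0) = κ)
    (h2 : ∀ z ∈ Ioo (-ε) ε ×ˢ univ, fderiv ℝ P z (1, 0) = 0)
    (h3 : ∀ z ∈ Ioo (-ε) ε ×ˢ univ, ∀ u v, fderiv ℝ P z u (1, 0) v = fderiv ℝ P z v (1, 0) u) :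
    ∃ (β : F → ℝ) (G : F → F →L[ℝ] F →L[ℝ] ℝ), ContDiff ℝ ∞ β ∧ ContDiff ℝ ∞ G ∧
      (∀ y v w, G y v w = G y w v) ∧ (∀ y v, v ≠ 0 → 0 < G y v v) ∧
      ∀ z ∈ Ioo (-ε) ε ×ˢ univ, ∀ u v, P z u v =
        (κ * u.1 + fderiv ℝ β z.2 u.2) * (κ * v.1 + fderiv ℝ β z.2 v.2) / κ +
          G z.2 u.2 v.2 := by
  have h0 : ∀ y : F, ((0 : ℝ), y) ∈ Ioo (-ε) ε ×ˢ (univ : Set F) := fun y =>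
    ⟨⟨by linarith, hε⟩, mem_univ _⟩
  let P₀ : F → ℝ × F →L[ℝ] ℝ × F →L[ℝ] ℝ := fun y => P (0, y)
  have hP₀ : ContDiff ℝ ∞ P₀ := by
    have h : ContDiff ℝ ∞ fun y : F => ((0 : ℝ), y) := contDiff_const.prodMk contDiff_id
    exact contDiffOn_univ.1 (hP.comp h.contDiffOn fun y _ => h0 y)
  let ι : F →L[ℝ] ℝ × F := ContinuousLinearMap.inr ℝ ℝ F
  let θ : F → F →L[ℝ] ℝ := fun y => (P₀ y (1, 0)).comp ι
  have hθ' : ∀ y v, θ y v = P₀ y (1, 0) (0, v) := fun y v => rfl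
  have hθs : ContDiff ℝ ∞ θ := by
    rw [contDiff_clm_apply_iff]
    intro v
    exact (hP₀.clm_apply contDiff_const).clm_apply contDiff_const
  have hθd : ∀ y u v, fderiv ℝ θ y u v = fderiv ℝ P (0, y) (0, u) (1, 0) (0, v) := by
    intro y u v
    have e1 : HasFDerivAt (fun y : F => ((0 : ℝ), y)) ι y :=
      (hasFDerivAt_const 0 y).prodMk (hasFDerivAt_id y)
    have e2 : HasFDerivAt P₀ ((fderiv ℝ P (0, y)).comp ι) y :=
      (((hP.contDiffAt ((isOpen_Ioo.prod isOpen_univ).mem_nhds (h0 y))).differentiableAt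
        (by simp)).hasFDerivAt).comp y e1
    have e3 := (e2.clm_apply (hasFDerivAt_const ((1 : ℝ), (0 : F)) y)).clm_apply
      (hasFDerivAt_const ((0 : ℝ), v) y)
    have e4 := (hθs.differentiable (by simp) y).hasFDerivAt.clm_apply (hasFDerivAt_const v y)
    have e5 := DFunLike.congr_fun (e4.unique e3) u
    simpa [ι] using e5
  -- The Poincaré lemma on all of `F`: `θ`, the restriction of the dual 1-form to the slice, is
  -- closed by `h3`.
  obtain ⟨β, hβ⟩ : ∃ β : F → ℝ, ∀ y ∈ univ, HasFDerivAt β (θ y) y := (convex_univ (𝕜 := ℝ) (E := F)).exists_forall_hasFDerivAt_of_fderiv_symmetric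
    isOpen_univ (hθs.differentiable (by simp)).differentiableOn
    (fun y _ u v => by rw [hθd, hθd, h3 _ (h0 y)])
  have hβθ : fderiv ℝ β = θ := funext fun y => (hβ y (mem_univ y)).fderiv
  let G : F → F →L[ℝ] F →L[ℝ] ℝ := fun y =>
    (P₀ y).bilinearComp ι ι - κ⁻¹ • (θ y).smulRight (θ y)
  have hG : ∀ y v w, G y v w = P₀ y (0, v) (0, w) - κ⁻¹ * (θ y v * θ y w) := by
    intro y v w
    simp [G, ι]
  have key : ∀ z ∈ Ioo (-ε) ε ×ˢ univ, ∀ u v, P z u v =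
      (κ * u.1 + θ z.2 u.2) * (κ * v.1 + θ z.2 v.2) / κ + G z.2 u.2 v.2 := by
    rintro z hz ⟨a, u⟩ ⟨b, v⟩
    rw [apply_eq_apply_zero hP h2 hz, hG]
    have e : ∀ (a : ℝ) (u : F), ((a, u) : ℝ × F) = a • ((1 : ℝ), (0 : F)) + ((0 : ℝ), u) := by
      intro a u; simp
    have hP1 : P₀ z.2 (1, 0) (1, 0) = κ := h1 _ (h0 _)
    have hPs : P₀ z.2 (0, u) (1, 0) = θ z.2 u := hs _ (h0 _) _ _
    have hPuv : P₀ z.2 (a, u) (b, v) = P₀ z.2 (a • (1, 0) + (0, u)) (b • (1, 0) + (0, v)) := by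
      rw [← e, ← e]
    refine hPuv.trans ?_
    simp only [map_add, map_smul, add_apply, smul_apply, smul_eq_mul, hP1, hPs, ← hθ']
    field_simp
    ring
  refine ⟨β, G, ?_, ?_, ?_, ?_, ?_⟩
  · rw [contDiff_infty_iff_fderiv, hβθ]
    exact ⟨fun y => (hβ y (mem_univ y)).differentiableAt, hθs⟩
  · rw [contDiff_clm_apply_iff]
    intro v
    rw [contDiff_clm_apply_iff]
    intro w
    simp only [hG]
    exact ((hP₀.clm_apply contDiff_const).clm_apply contDiff_const).sub (contDiff_const.mul
      ((hθs.clm_apply contDiff_const).mul (hθs.clm_apply contDiff_const)))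
  · intro y v w
    rw [hG, hG, mul_comm (θ y v)]
    congr 1
    exact hs _ (h0 y) _ _
  · intro y v hv
    -- This lift of `v` is orthogonal to ∂_s, so the square drops out and `G` is the value of the
    -- positive form `P`.
    have e := key (0, y) (h0 y) (-(θ y v) / κ, v) (-(θ y v) / κ, v)
    have e1 : κ * (-(θ y v) / κ) + θ y v = 0 := by field_simp; ring
    simp only [e1, zero_mul, zero_div, zero_add] at e
    rw [← e]
    exact hp _ (h0 y) _ fun h => hv (congrArg Prod.snd h)
  · rw [hβθ]
    exact key

end Decomposition

/-! ### Lifting tangent fields through an immersion. -/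

section Lift

variable {E' : Type*} [NormedAddCommGroup E'] [NormedSpace ℝ E']
  {H' : Type*} [TopologicalSpace H'] {J : ModelWithCorners ℝ E' H'}
  {N : Type*} [TopologicalSpace N] [ChartedSpace H' N] [IsManifold J ∞ N]
  {E₀ : Type*} [NormedAddCommGroup E₀] [NormedSpace ℝ E₀] [FiniteDimensional ℝ E₀]

/-- A smooth field along an immersion which is tangent to it is the image of a smooth field. -/
theorem exists_smooth_lift (g : ContMDiffRiemannianMetric J ∞ E' (fun x : N => TangentSpace J x))
    {h : E₀ → N} {U : Set E₀} (hU : IsOpen U) (hh : ContMDiffOn 𝓘(ℝ, E₀) J ∞ h U)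
    (hinj : ∀ y ∈ U, Function.Injective (modelDeriv 𝓘(ℝ, E₀) J h y))
    {Z : ∀ y : E₀, TangentSpace J (h y)}
    (hZ : ContMDiffOn 𝓘(ℝ, E₀) J.tangent ∞ (fun y => (⟨h y, Z y⟩ : TangentBundle J N)) U)
    (ht : ∀ y ∈ U, ∃ w : E₀, modelDeriv 𝓘(ℝ, E₀) J h y w = Z y) :
    ∃ V : E₀ → E₀, ContDiffOn ℝ ∞ V U ∧ ∀ y ∈ U, modelDeriv 𝓘(ℝ, E₀) J h y (V y) = Z y := by
  classical
  choose! V hV using ht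
  refine ⟨V, ?_, hV⟩
  let G := metricAt (pullbackMetric 𝓘(ℝ, E₀) g.inner h)
  let l : E₀ → E₀ →L[ℝ] ℝ := fun y => (metricAt g.inner (h y) (Z y)).comp (modelDeriv 𝓘(ℝ, E₀) J h y)
  have hl : ContDiffOn ℝ ∞ l U := by
    rw [contDiffOn_clm_apply]
    intro u
    exact (contMDiffOn_metric g hZ (contMDiffOn_mfderiv_const hU hh u)).contDiffOn
  have hp : ∀ y ∈ U, ∀ v, v ≠ 0 → 0 < G y v v := fun y hy v hv =>
    g.pos _ _ fun h0 => hv (hinj y hy (h0.trans (map_zero _).symm))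
  -- The pointwise preimage is given by a smooth formula: it is the vector representing `l y` in the
  -- induced metric.
  refine ((contDiffOn_inverse_of_pos (contDiffOn_pullbackMetric g hU hh) hp).clm_apply hl).congr
    fun y hy => ?_
  have h1 : G y ((G y).inverse (l y)) = l y := apply_inverse_of_pos (G y) (hp y hy) (l y)
  have h2 : G y (V y) = l y := by
    ext u
    exact congrArg (fun v : E' => metricAt g.inner (h y) v (modelDeriv 𝓘(ℝ, E₀) J h y u)) (hV y hy)
  have h3 : G y (V y - (G y).inverse (l y)) = 0 := by rw [map_sub, h1, h2, sub_self]
  by_contra h4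
  have h5 := hp y hy _ (sub_ne_zero.2 h4)
  rw [h3] at h5
  simp at h5

end Lift

/-! ### The local product structure when Y is tangent. -/

section LocalProduct

theorem pullbackMetric_lineProductMetric {E : Type*} [NormedAddCommGroup E] [NormedSpace ℝ E]
    {H : Type*} [TopologicalSpace H] {I : ModelWithCorners ℝ E H}
    {M : Type*} [TopologicalSpace M] [ChartedSpace H M]
    {E' : Type*} [NormedAddCommGroup E'] [NormedSpace ℝ E']
    {H' : Type*} [TopologicalSpace H'] {J : ModelWithCorners ℝ E' H'}
    {N : Type*} [TopologicalSpace N] [ChartedSpace H' N]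
    (g : MetricField J N) {a : M → ℝ} {b : M → N} {q : M} (ha : MDifferentiableAt I 𝓘(ℝ, ℝ) a q)
    (hb : MDifferentiableAt I J b q) (u v : E) :
    metricAt (pullbackMetric I (lineProductMetric g) fun q => (a q, b q)) q u v =
      modelDeriv I 𝓘(ℝ, ℝ) a q u * modelDeriv I 𝓘(ℝ, ℝ) a q v +
        metricAt g (b q) (modelDeriv I J b q u) (modelDeriv I J b q v) := by
  have hab := ha.prodMk hb
  have h1 : modelDeriv I 𝓘(ℝ, ℝ) a q = (modelDeriv (𝓘(ℝ, ℝ).prod J) 𝓘(ℝ, ℝ) Prod.fst (a q, b q)).comp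
      (modelDeriv I (𝓘(ℝ, ℝ).prod J) (fun q => (a q, b q)) q) :=
    mfderiv_comp (g := (Prod.fst : ℝ × N → ℝ)) (f := fun q => (a q, b q)) q mdifferentiableAt_fst hab
  have h2 : modelDeriv I J b q = (modelDeriv (𝓘(ℝ, ℝ).prod J) J Prod.snd (a q, b q)).comp
      (modelDeriv I (𝓘(ℝ, ℝ).prod J) (fun q => (a q, b q)) q) :=
    mfderiv_comp (g := (Prod.snd : ℝ × N → N)) (f := fun q => (a q, b q)) q mdifferentiableAt_snd hab
  rw [h1, h2, mul_comm]
  rfl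

variable {E : Type*} [NormedAddCommGroup E] [NormedSpace ℝ E] [FiniteDimensional ℝ E]
  {M : Type*} [TopologicalSpace M] [ChartedSpace E M] [IsManifold 𝓘(ℝ, E) ∞ M]
  {E' : Type*} [NormedAddCommGroup E'] [NormedSpace ℝ E'] [FiniteDimensional ℝ E']
  {H' : Type*} [TopologicalSpace H'] {J : ModelWithCorners ℝ E' H'} [J.Boundaryless]
  {N : Type*} [TopologicalSpace N] [ChartedSpace H' N] [IsManifold J ∞ N]
  {g : ContMDiffRiemannianMetric J ∞ E' (fun x : N => TangentSpace J x)}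
  {f : M → N} {Y : ∀ p : M, TangentSpace J (f p)}

theorem covD_congr {E₀ : Type*} [NormedAddCommGroup E₀] [NormedSpace ℝ E₀] (g : MetricField J N)
    {h : E₀ → N} {V W : ∀ z : E₀, TangentSpace J (h z)} {z : E₀} (hVW : ∀ᶠ z in 𝓝 z, V z = W z)
    (w : E₀) : covD 𝓘(ℝ, E₀) g h V z w = covD 𝓘(ℝ, E₀) g h W z w := by
  have h1 : coordField J h V (h z) =ᶠ[𝓝 z] coordField J h W (h z) := by
    filter_upwards [hVW] with q hq
    unfold coordField
    rw [hq]
  have h2 : modelDeriv 𝓘(ℝ, E₀) 𝓘(ℝ, E') (coordField J h V (h z)) z =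
    modelDeriv 𝓘(ℝ, E₀) 𝓘(ℝ, E') (coordField J h W (h z)) z := h1.mfderiv_eq
  rw [covD_eq, covD_eq, h2]
  have h3 := hVW.self_of_nhds
  rw [h3]

/-- Coordinates adapted to a tangent field. -/
theorem exists_straightening {F : Type*} [NormedAddCommGroup F] [InnerProductSpace ℝ F]
    [FiniteDimensional ℝ F] (hEF : Module.finrank ℝ E = Module.finrank ℝ F + 1)
    (g : ContMDiffRiemannianMetric J ∞ E' (fun x : N => TangentSpace J x))
    (hf : IsSmoothImmersion 𝓘(ℝ, E) J f) (hY : IsSmoothAlong 𝓘(ℝ, E) J f Y)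
    (ht : ∀ p, IsTangentAt 𝓘(ℝ, E) f p (Y p)) {p : M} (hp : Y p ≠ 0) :
    ∃ (Θ : OpenPartialHomeomorph (ℝ × F) M) (ε : ℝ), 0 < ε ∧ Θ.source = Ioo (-ε) ε ×ˢ univ ∧
      p ∈ Θ.target ∧ ContMDiffOn 𝓘(ℝ, ℝ × F) 𝓘(ℝ, E) ∞ Θ Θ.source ∧
      ContMDiffOn 𝓘(ℝ, E) 𝓘(ℝ, ℝ × F) ∞ Θ.symm Θ.target ∧
      ∀ z ∈ Θ.source, modelDeriv 𝓘(ℝ, ℝ × F) J (f ∘ Θ) z (1, 0) = Y (Θ z) := by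
  let ψ := chartAt E p
  have hψ : ContMDiffOn 𝓘(ℝ, E) 𝓘(ℝ, E) ∞ ψ ψ.source := contMDiffOn_chart
  have hψs : ContMDiffOn 𝓘(ℝ, E) 𝓘(ℝ, E) ∞ ψ.symm ψ.target := contMDiffOn_chart_symm
  have hψd : ∀ y ∈ ψ.target, MDifferentiableAt 𝓘(ℝ, E) 𝓘(ℝ, E) ψ.symm y := fun y hy =>
    (hψs.contMDiffAt (ψ.open_target.mem_nhds hy)).mdifferentiableAt (by simp)
  let h₀ : E → N := f ∘ ψ.symm
  have hh₀ : ContMDiffOn 𝓘(ℝ, E) J ∞ h₀ ψ.target := hf.1.comp_contMDiffOn hψs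
  have hcomp : ∀ y ∈ ψ.target, modelDeriv 𝓘(ℝ, E) J h₀ y =
      (modelDeriv 𝓘(ℝ, E) J f (ψ.symm y)).comp (modelDeriv 𝓘(ℝ, E) 𝓘(ℝ, E) ψ.symm y) :=
    fun y hy => mfderiv_comp y ((hf.1 _).mdifferentiableAt (by simp)) (hψd y hy)
  have hinv : ∀ y ∈ ψ.target, (modelDeriv 𝓘(ℝ, E) 𝓘(ℝ, E) ψ (ψ.symm y)).comp
      (modelDeriv 𝓘(ℝ, E) 𝓘(ℝ, E) ψ.symm y) = ContinuousLinearMap.id ℝ E := by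
    intro y hy
    have h1 := (((hψ.contMDiffAt (ψ.open_source.mem_nhds (ψ.map_target hy))).mdifferentiableAt
      (by simp)).hasMFDerivAt.comp y (hψd y hy).hasMFDerivAt)
    have h2 : (ψ ∘ ψ.symm : E → E) =ᶠ[𝓝 y] id := by
      filter_upwards [ψ.open_target.mem_nhds hy] with z hz using ψ.right_inv hz
    exact (h1.congr_of_eventuallyEq h2.symm).mfderiv.symm.trans mfderiv_id
  have hinj' : ∀ y ∈ ψ.target,
      Function.Injective (modelDeriv 𝓘(ℝ, E) 𝓘(ℝ, E) ψ.symm y) := fun y hy =>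
    Function.LeftInverse.injective fun v => DFunLike.congr_fun (hinv y hy) v
  have hinj : ∀ y ∈ ψ.target, Function.Injective (modelDeriv 𝓘(ℝ, E) J h₀ y) := by
    intro y hy
    rw [hcomp y hy]
    exact (hf.2 _).comp (hinj' y hy)
  obtain ⟨V, hV, hVZ⟩ := exists_smooth_lift (Z := fun y => Y (ψ.symm y)) g ψ.open_target hh₀ hinj
    (ContMDiff.comp_contMDiffOn (I' := 𝓘(ℝ, E)) hY hψs) fun y hy => by
      obtain ⟨w, hw⟩ := ht (ψ.symm y)
      have hsurj := LinearMap.injective_iff_surjective.1 (hinj' y hy)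
      obtain ⟨w', hw'⟩ := hsurj w
      refine ⟨w', ?_⟩
      rw [hcomp y hy]
      exact (congrArg (modelDeriv 𝓘(ℝ, E) J f (ψ.symm y)) hw').trans hw
  have hpt : ψ p ∈ ψ.target := ψ.map_source (mem_chart_source E p)
  have hV0 : V (ψ p) ≠ 0 := by
    intro h
    have h1 := hVZ _ hpt
    rw [h, map_zero] at h1
    have h2 : ψ.symm (ψ p) = p := ψ.left_inv (mem_chart_source E p)
    have h3 : Y (ψ.symm (ψ p)) = 0 := h1.symm
    rw [h2] at h3
    exact hp h3
  obtain ⟨Ψ, ε, hε, hsrc, hx, htgt, hΨ, hΨs, hΨV⟩ := exists_flowBox hEF ψ.open_target hV hpt hV0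
  have hsource : (Ψ.trans ψ.symm).source = Ψ.source := by
    rw [OpenPartialHomeomorph.trans_source]
    exact inter_eq_left.2 fun z hz => htgt (Ψ.map_source hz)
  have hpT : p ∈ (Ψ.trans ψ.symm).target := by
    rw [OpenPartialHomeomorph.trans_target]
    exact ⟨mem_chart_source E p, hx⟩
  refine ⟨Ψ.trans ψ.symm, ε, hε, hsource.trans hsrc, hpT, ?_, ?_, ?_⟩
  · rw [hsource]
    exact hψs.comp hΨ.contMDiffOn fun z hz => htgt (Ψ.map_source hz)
  · rw [OpenPartialHomeomorph.trans_target]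
    exact hΨs.contMDiffOn.comp (hψ.mono inter_subset_left) fun z hz => hz.2
  · rw [hsource]
    intro z hz
    have hzt : Ψ z ∈ ψ.target := htgt (Ψ.map_source hz)
    have h1 := HasMFDerivAt.comp z
      ((hh₀.contMDiffAt (ψ.open_target.mem_nhds hzt)).mdifferentiableAt (by simp)).hasMFDerivAt
      ((hΨ.contDiffAt (Ψ.open_source.mem_nhds hz)).differentiableAt (by simp)).hasFDerivAt.hasMFDerivAt
    have h2 : modelDeriv 𝓘(ℝ, ℝ × F) J (h₀ ∘ Ψ) z =
      (modelDeriv 𝓘(ℝ, E) J h₀ (Ψ z)).comp (fderiv ℝ Ψ z) := h1.mfderiv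
    have h3 : modelDeriv 𝓘(ℝ, ℝ × F) J (h₀ ∘ Ψ) z (1, 0) = Y (ψ.symm (Ψ z)) := by
      rw [h2, ContinuousLinearMap.comp_apply, hΨV z hz]
      exact hVZ _ hzt
    exact h3

/-- The coordinate field in the direction `e` is Y itself, so it inherits parallelism through the
chain rule. -/
theorem covD_straightening {E₀ : Type*} [NormedAddCommGroup E₀] [NormedSpace ℝ E₀]
    (hf : ContMDiff 𝓘(ℝ, E) J ∞ f) (hY : IsParallelAlong 𝓘(ℝ, E) g.inner f Y)
    {k : E₀ → M} {U : Set E₀} (hU : IsOpen U) (hk : ContMDiffOn 𝓘(ℝ, E₀) 𝓘(ℝ, E) ∞ k U) {e : E₀}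
    (he : ∀ z ∈ U, modelDeriv 𝓘(ℝ, E₀) J (f ∘ k) z e = Y (k z)) {z : E₀} (hz : z ∈ U) (w : E₀) :
    covD 𝓘(ℝ, E₀) g.inner (f ∘ k) (fun z => mfderiv 𝓘(ℝ, E₀) J (f ∘ k) z e) z w = 0 := by
  have h1 := covD_congr (h := f ∘ k) (V := fun z => mfderiv 𝓘(ℝ, E₀) J (f ∘ k) z e)
    (W := fun z => Y (k z)) g.inner (by filter_upwards [hU.mem_nhds hz] with z hz using he z hz) w
  have h2 := covD_comp g.inner ((hk.contMDiffAt (hU.mem_nhds hz)).mdifferentiableAt (by simp))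
    ((hf _).mdifferentiableAt (by simp)) (hY.1.mdifferentiableAt_coordField (k z)) w
  exact h1.trans (h2.trans (hY.2 _ _))

/-- The shear `(s, y) ↦ (r s + β y / r, y)`. -/
def shear {F : Type*} [TopologicalSpace F] {r : ℝ} (hr : r ≠ 0) {β : F → ℝ} (hβ : Continuous β) :
    (ℝ × F) ≃ₜ (ℝ × F) where
  toFun z := (r * z.1 + β z.2 / r, z.2)
  invFun z := ((z.1 - β z.2 / r) / r, z.2)
  left_inv z := by ext <;> simp [hr]
  right_inv z := by ext <;> simp [mul_div_cancel₀ _ hr]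
  continuous_toFun := by fun_prop
  continuous_invFun := by fun_prop

theorem IsHelix.isLocallyLineProduct [ConnectedSpace M] {m : ℕ}
    (hE : Module.finrank ℝ E = m + 1) (hf : IsSmoothImmersion 𝓘(ℝ, E) J f)
    (hM : IsHelix 𝓘(ℝ, E) g.inner f Y) (hY : ∃ p, Y p ≠ 0) {p₀ : M}
    (hp₀ : IsTangentAt 𝓘(ℝ, E) f p₀ (Y p₀)) :
    IsLocallyLineProduct (pullbackMetric 𝓘(ℝ, E) g.inner f) := by
  let F := EuclideanSpace ℝ (Fin m)
  have hEF : Module.finrank ℝ E = Module.finrank ℝ F + 1 := by rw [hE, finrank_euclideanSpace_fin]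
  have hg := isMetric_inner g
  obtain ⟨c, hc⟩ := hM.exists_metric_tanPart hf
  have ht : ∀ p, IsTangentAt 𝓘(ℝ, E) f p (Y p) := by
    intro p
    rw [isTangentAt_iff_metric (g := g) hf, hc] at hp₀ ⊢
    rw [← hp₀, hM.1.metric_self_eq hf.1]
  have hκ : ∀ p, metricAt g.inner (f p) (Y p) (Y p) = c := fun p =>
    ((isTangentAt_iff_metric (g := g) hf p).1 (ht p)).trans (hc p)
  obtain ⟨p₁, hp₁⟩ := hY
  have hc0 : 0 < c := by
    rw [← hκ p₁]
    exact hg.pos _ _ hp₁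
  intro p
  have hYp : Y p ≠ 0 := by
    intro h0
    have h1 := hκ p
    have h2 : metricAt g.inner (f p) (Y p) = 0 := by
      have h3 : metricAt g.inner (f p) 0 = 0 := map_zero _
      exact (congrArg (metricAt g.inner (f p)) h0).trans h3
    rw [h2] at h1
    exact hc0.ne h1
  obtain ⟨Θ, ε, hε, hsrc, hpT, hΘ, hΘs, hΘY⟩ :=
    exists_straightening (F := F) hEF g hf hM.1.1 ht hYp
  let h : ℝ × F → N := f ∘ Θ
  have hh : ContMDiffOn 𝓘(ℝ, ℝ × F) J ∞ h Θ.source := hf.1.comp_contMDiffOn hΘ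
  have hhd : ∀ z ∈ Θ.source, ContMDiffAt 𝓘(ℝ, ℝ × F) J ∞ h z := fun z hz =>
    hh.contMDiffAt (Θ.open_source.mem_nhds hz)
  have hΘsd : ∀ q ∈ Θ.target, MDifferentiableAt 𝓘(ℝ, E) 𝓘(ℝ, ℝ × F) Θ.symm q := fun q hq =>
    (hΘs.contMDiffAt (Θ.open_target.mem_nhds hq)).mdifferentiableAt (by simp)
  have hinj : ∀ z ∈ Θ.source, Function.Injective (modelDeriv 𝓘(ℝ, ℝ × F) J h z) := by
    intro z hz
    have hd : MDifferentiableAt 𝓘(ℝ, ℝ × F) 𝓘(ℝ, E) Θ z :=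
      (hΘ.contMDiffAt (Θ.open_source.mem_nhds hz)).mdifferentiableAt (by simp)
    have h1 : modelDeriv 𝓘(ℝ, ℝ × F) J h z =
        (modelDeriv 𝓘(ℝ, E) J f (Θ z)).comp (modelDeriv 𝓘(ℝ, ℝ × F) 𝓘(ℝ, E) Θ z) :=
      mfderiv_comp z ((hf.1 _).mdifferentiableAt (by simp)) hd
    have h2 : (modelDeriv 𝓘(ℝ, E) 𝓘(ℝ, ℝ × F) Θ.symm (Θ z)).comp
        (modelDeriv 𝓘(ℝ, ℝ × F) 𝓘(ℝ, E) Θ z) = ContinuousLinearMap.id ℝ (ℝ × F) := by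
      have h3 := (hΘsd _ (Θ.map_source hz)).hasMFDerivAt.comp z hd.hasMFDerivAt
      have h4 : (Θ.symm ∘ Θ : ℝ × F → ℝ × F) =ᶠ[𝓝 z] id := by
        filter_upwards [Θ.open_source.mem_nhds hz] with z hz using Θ.left_inv hz
      exact (h3.congr_of_eventuallyEq h4.symm).mfderiv.symm.trans mfderiv_id
    rw [h1]
    exact (hf.2 _).comp (Function.LeftInverse.injective fun v => DFunLike.congr_fun h2 v)
  let P := metricAt (pullbackMetric 𝓘(ℝ, ℝ × F) g.inner h)
  have hP : ContDiffOn ℝ ∞ P Θ.source := contDiffOn_pullbackMetric g Θ.open_source hh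
  have hcov : ∀ z ∈ Θ.source, ∀ w : ℝ × F, covD 𝓘(ℝ, ℝ × F) g.inner h
      (fun z => mfderiv 𝓘(ℝ, ℝ × F) J h z ((1, 0) : ℝ × F)) z w = 0 := fun z hz w =>
    covD_straightening hf.1 hM.1 Θ.open_source hΘ hΘY hz w
  have hfd : ∀ z ∈ Θ.source, ∀ u v w, fderiv ℝ P z u v w = _ := fun z hz u v w =>
    fderiv_pullbackMetric g Θ.open_source hh hz u v w
  have hsymm := fun z hz u w => covD_mfderiv_symm (z := z) hg (hhd z hz) u w
  obtain ⟨β, G, hβ, hG, hGs, hGp, hPG⟩ := exists_line_decomposition (P := P) hε hc0 (hsrc ▸ hP)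
    (fun z _ u v => g.symm _ _ _)
    (fun z hz u hu => g.pos _ _ fun h0 => hu (hinj z (hsrc ▸ hz) (h0.trans (map_zero _).symm)))
    (fun z hz => by
      have h1 : P z (1, 0) (1, 0) = metricAt g.inner (h z)
        (modelDeriv 𝓘(ℝ, ℝ × F) J h z (1, 0)) (modelDeriv 𝓘(ℝ, ℝ × F) J h z (1, 0)) := rfl
      rw [h1, hΘY z (hsrc ▸ hz)]
      exact hκ _)
    (fun z hz => by
      rw [← hsrc] at hz
      refine ContinuousLinearMap.ext fun u => ContinuousLinearMap.ext fun v => ?_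
      -- Torsion-freeness turns ∇_s ∂_u into ∇_u ∂_s, which is zero: the field ∂_s is Killing.
      rw [hfd z hz, hsymm z hz u, hsymm z hz v, hcov z hz, hcov z hz]
      simp)
    (fun z hz u v => by
      rw [← hsrc] at hz
      -- With ∇∂_s = 0 only g(∂_s, ∇_u ∂_v) remains, which is symmetric in `u` and `v`: the dual
      -- 1-form is closed.
      rw [hfd z hz, hfd z hz, hcov z hz, hcov z hz, hsymm z hz u, map_zero]
      simp)
  -- The form c ds + dβ has length √c, so dividing it by `r` gives the differential of the
  -- unit-speed coordinate r s + β/r.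
  set r := √c with hr
  have hr0 : 0 < r := Real.sqrt_pos.2 hc0
  have hrr : r * r = c := Real.mul_self_sqrt hc0.le
  let Φ : OpenPartialHomeomorph M (ℝ × F) := Θ.symm.transHomeomorph (shear hr0.ne' hβ.continuous)
  let a : ℝ × F → ℝ := fun z => r * z.1 + β z.2 / r
  have ha : ContDiff ℝ ∞ a :=
    (contDiff_const.mul contDiff_fst).add ((hβ.comp contDiff_snd).div_const r)
  have hinv : ContMDiff (𝓘(ℝ, ℝ).prod 𝓘(ℝ, F)) 𝓘(ℝ, ℝ × F) ∞
      (shear hr0.ne' hβ.continuous).symm := by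
    have h1 : ContMDiff (𝓘(ℝ, ℝ).prod 𝓘(ℝ, F)) 𝓘(ℝ, ℝ × F) ∞ (fun z : ℝ × F => (z.1, z.2)) :=
      contMDiff_fst.prodMk_space contMDiff_snd
    have h2 : ContDiff ℝ ∞ (fun z : ℝ × F => ((z.1 - β z.2 / r) / r, z.2)) :=
      ((contDiff_fst.sub ((hβ.comp contDiff_snd).div_const r)).div_const r).prodMk contDiff_snd
    exact h2.contMDiff.comp h1
  refine ⟨m, F, inferInstance, inferInstance, inferInstance, inferInstance, inferInstance,
    riemannianMetricOfContDiff G hG hGs hGp, Φ, hpT, ?_, ?_, ?_⟩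
  · exact (ha.contMDiff.comp_contMDiffOn hΘs).prodMk (contDiff_snd.contMDiff.comp_contMDiffOn hΘs)
  · exact hΘ.comp hinv.contMDiffOn fun z hz => hz
  · intro q hq
    have hqT : q ∈ Θ.target := hq
    set z := Θ.symm q with hz
    have hzs : z ∈ Θ.source := Θ.map_target hqT
    let D := modelDeriv 𝓘(ℝ, E) 𝓘(ℝ, ℝ × F) Θ.symm q
    have had : modelDeriv 𝓘(ℝ, E) 𝓘(ℝ, ℝ) (a ∘ Θ.symm) q = (fderiv ℝ a z).comp D :=
      ((ha.differentiable (by simp) z).hasFDerivAt.hasMFDerivAt.comp q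
        (hΘsd q hqT).hasMFDerivAt).mfderiv
    have hbd : modelDeriv 𝓘(ℝ, E) 𝓘(ℝ, F) (Prod.snd ∘ Θ.symm) q =
        (ContinuousLinearMap.snd ℝ ℝ F).comp D :=
      ((hasFDerivAt_snd (𝕜 := ℝ) (p := z)).hasMFDerivAt.comp q (hΘsd q hqT).hasMFDerivAt).mfderiv
    have hfd : modelDeriv 𝓘(ℝ, E) J f q = (modelDeriv 𝓘(ℝ, ℝ × F) J h z).comp D := by
      have h1 := ((hhd z hzs).mdifferentiableAt (by simp)).hasMFDerivAt.comp q
        (hΘsd q hqT).hasMFDerivAt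
      have h2 : f =ᶠ[𝓝 q] h ∘ Θ.symm := by
        filter_upwards [Θ.open_target.mem_nhds hqT] with q hq
        exact (congrArg f (Θ.right_inv hq)).symm
      exact (h1.congr_of_eventuallyEq h2).mfderiv
    have hda : ∀ u : ℝ × F, fderiv ℝ a z u = r * u.1 + fderiv ℝ β z.2 u.2 / r := by
      intro u
      have h1 := (hasFDerivAt_fst (𝕜 := ℝ) (p := z)).const_mul r
      have h2 : HasFDerivAt (fun z : ℝ × F => β z.2)
          ((fderiv ℝ β z.2).comp (ContinuousLinearMap.snd ℝ ℝ F)) z :=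
        (hβ.differentiable (by simp) z.2).hasFDerivAt.comp z hasFDerivAt_snd
      have h3 := (h1.add (h2.mul_const r⁻¹)).fderiv
      have h4 : a = (fun z : ℝ × F => r * z.1) + fun z : ℝ × F => β z.2 * r⁻¹ := by
        ext z; simp [a, div_eq_mul_inv]
      rw [h4, h3]
      simp [div_eq_mul_inv, mul_comm]
    have hfq : f q = h z := congrArg f (Θ.right_inv hqT).symm
    have hmain : metricAt (pullbackMetric 𝓘(ℝ, E)
        (lineProductMetric (riemannianMetricOfContDiff G hG hGs hGp).inner) Φ) q =
        metricAt (pullbackMetric 𝓘(ℝ, E) g.inner f) q := by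
      ext u v
      have h1 := pullbackMetric_lineProductMetric (riemannianMetricOfContDiff G hG hGs hGp).inner
        (a := a ∘ Θ.symm) (b := Prod.snd ∘ Θ.symm)
        (((ha.contMDiff z).mdifferentiableAt (by simp)).comp q (hΘsd q hqT))
        ((contDiff_snd.contMDiff (n := ∞) z).mdifferentiableAt (by simp) |>.comp q (hΘsd q hqT)) u v
      have h2 : metricAt (pullbackMetric 𝓘(ℝ, E) g.inner f) q u v =
          metricAt g.inner (f q) (modelDeriv 𝓘(ℝ, E) J f q u) (modelDeriv 𝓘(ℝ, E) J f q v) := rfl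
      have h3 : metricAt g.inner (h z) (modelDeriv 𝓘(ℝ, ℝ × F) J h z (D u))
        (modelDeriv 𝓘(ℝ, ℝ × F) J h z (D v)) = P z (D u) (D v) := rfl
      refine h1.trans ?_
      rw [h2, hfd, hfq, had, hbd]
      simp only [ContinuousLinearMap.comp_apply]
      rw [h3, hPG z (hsrc ▸ hzs), hda, hda]
      have h4 : ∀ s t x y : ℝ, (r * s + x / r) * (r * t + y / r) =
          (c * s + x) * (c * t + y) / c := by
        intro s t x y
        rw [← hrr]
        field_simp
      rw [h4]
      rfl
    exact hmain

end LocalProduct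

end HelixHypersurface

end

/-! ### The theorem. -/

open HelixHypersurface in
theorem mainTheorem6 {n : ℕ}
    {N : Type*} [TopologicalSpace N] [T2Space N] [SecondCountableTopology N]
    [ChartedSpace (EuclideanSpace ℝ (Fin (n + 1))) N] [IsManifold (𝓡 (n + 1)) ∞ N]
    (g : ContMDiffRiemannianMetric (𝓡 (n + 1)) ∞ (EuclideanSpace ℝ (Fin (n + 1)))
      (fun x : N => TangentSpace (𝓡 (n + 1)) x))
    {M : Type*} [TopologicalSpace M] [T2Space M] [SecondCountableTopology M] [ConnectedSpace M]
    [ChartedSpace (EuclideanSpace ℝ (Fin n)) M] [IsManifold (𝓡 n) ∞ M]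
    (f : M → N) (hf : IsSmoothImmersion (𝓡 n) (𝓡 (n + 1)) f)
    (Y : ∀ p : M, TangentSpace (𝓡 (n + 1)) (f p)) (hY : ∃ p, Y p ≠ 0)
    (hM : IsHelix (𝓡 n) g.inner f Y) :
    ((∃ p, IsOrthogonalAt (𝓡 n) g.inner f p (Y p)) →
      IsTotallyGeodesic (𝓡 n) g.inner f) ∧
    ((∃ p, IsTangentAt (𝓡 n) f p (Y p)) →
      IsLocallyLineProduct (pullbackMetric (𝓡 n) g.inner f)) ∧
    ((∃ p, IsTransversalAt (𝓡 n) f p (Y p)) →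
      (∀ (α : ℝ → M) (s : Set ℝ), IsOpen s → s.OrdConnected →
        IsMIntegralCurveOn α (tangentialPart (𝓡 n) g.inner f Y) s →
        IsGeodesicOn (pullbackMetric (𝓡 n) g.inner f) α s) →
      ∀ (α : ℝ → M) (s : Set ℝ), IsOpen s → s.OrdConnected →
        IsMIntegralCurveOn α (tangentialPart (𝓡 n) g.inner f Y) s →
        IsGeodesicOn g.inner (f ∘ α) s) := by
  have hEE : Module.finrank ℝ (EuclideanSpace ℝ (Fin (n + 1))) =
      Module.finrank ℝ (EuclideanSpace ℝ (Fin n)) + 1 := by simp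
  refine ⟨fun ⟨p, hp⟩ => hM.isTotallyGeodesic hEE hf hY hp, fun ⟨p, hp⟩ => ?_,
    fun ⟨p, hp⟩ hgeo α s hs hs' hα =>
      hM.isGeodesicOn_comp hEE hf hp.2 hs hα (hgeo α s hs hs' hα)⟩
  cases n with
  | zero =>
    -- In dimension 0 there is no unit tangent vector, so the maximum in the helix condition cannot
    -- be attained.
    obtain ⟨-, c, hc⟩ := hM
    obtain ⟨w, hw, -⟩ := (hc p).1
    have hw0 : w = 0 := Subsingleton.elim (α := EuclideanSpace ℝ (Fin 0)) _ _
    rw [hw0] at hw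
    have h0 : (0 : ℝ) = 1 := by
      refine Eq.trans ?_ hw
      rw [map_zero, map_zero]
    exact absurd h0 zero_ne_one
  | succ m => exact hM.isLocallyLineProduct (m := m) (by simp) hf hY hp
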